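/- Let $P$ be a convex decagon in the Euclidean plane $\mathbb{E}^2$ (exactly ten vertices), centrally symmetric and centred at the origin, and let $X$ be a discrete multiset of points of $\mathbb{E}^2$. Suppose that $P+X$ is a five-fold translative tiling of $\mathbb{E}^2$: counted with multiplicity, every point of $\mathbb{E}^2$ lies in at least five of the translates $P+\mathbf{x}$, $\mathbf{x}\in X$, and in at most five of the translates $\mathrm{int}(P)+\mathbf{x}$, $\mathbf{x}\in X$. Then $P+X$ is a five-fold lattice tiling: there are a two-dimensional lattice $\Lambda\subset\mathbb{E}^2$ and a point $\mathbf{x}_0\in\mathbb{E}^2$ such that $X=\mathbf{x}_0+\Lambda$, every point having multiplicity one (in particular, $X=\Lambda$ if $\mathbf{o}\in X$), and $P+\Lambda$ is itself a five-fold tiling of $\mathbb{E}^2$. -/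

import Mathlib

/-- The Euclidean plane. -/
abbrev Plane : Type := EuclideanSpace ℝ (Fin 2)

/-- Twice the signed area of the triangle `a b c`; it is positive exactly when `a`, `b`, `c` are
not collinear and are listed in anticlockwise order. -/
def orient (a b c : Plane) : ℝ :=
  (b 0 - a 0) * (c 1 - a 1) - (b 1 - a 1) * (c 0 - a 0)

/-- `P` is a (solid) convex `n`-gon, `n ≥ 3`: the convex hull of `n` points which, listed
in anticlockwise order, are the vertices of a convex polygon with no degenerate angle
(so `P` has exactly `n` vertices). -/
def IsConvexPolygon (n : ℕ) (P : Set Plane) : Prop :=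
  3 ≤ n ∧ ∃ v : Fin n → Plane,
    (∀ i j k : Fin n, i < j → j < k → 0 < orient (v i) (v j) (v k)) ∧
      P = convexHull ℝ (Set.range v)

/-- `K` is centrally symmetric with centre at the origin. -/
def IsCentredSymmetric (K : Set Plane) : Prop :=
  ∀ p ∈ K, -p ∈ K

/-- A multiset of points of the plane is given as a family `X : ι → Plane`: the multiplicity of a
point is the number of indices at which it occurs. It is discrete if every point of the multiset
has a neighbourhood that contains only finitely many members, counted with multiplicity. -/
def IsDiscreteMultiset {ι : Type*} (X : ι → Plane) : Prop :=
  ∀ j, ∃ U ∈ nhds (X j), {i | X i ∈ U}.Finite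

/-- `K + X` is a `k`-fold translative tiling: every point of the plane lies in at least `k` of
the translates `K + X i` and in at most `k` of the translates `interior K + X i`,
counted with multiplicity. -/
def IsFoldTiling {ι : Type*} (k : ℕ) (K : Set Plane) (X : ι → Plane) : Prop :=
  ∀ p : Plane,
    (k : ℕ∞) ≤ {i | p - X i ∈ K}.encard ∧ {i | p - X i ∈ interior K}.encard ≤ (k : ℕ∞)

/-- The multiset `X` is a translate `x₀ + Λ` of the lattice `Λ`, each point having
multiplicity one. -/
def IsTranslateOf {ι : Type*} (X : ι → Plane) (Λ : Submodule ℤ Plane) : Prop :=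
  Function.Injective X ∧ ∃ x₀ : Plane, Set.range X = {x | x - x₀ ∈ Λ}

/-- `K + X` is a `k`-fold lattice tiling: it is a `k`-fold tiling and, up to the choice of the
origin, `X` is a two-dimensional lattice `Λ`, for which `K + Λ` is a `k`-fold tiling. -/
def IsFoldLatticeTiling {ι : Type*} (k : ℕ) (K : Set Plane) (X : ι → Plane) : Prop :=
  IsFoldTiling k K X ∧
    ∃ (Λ : Submodule ℤ Plane) (_ : DiscreteTopology Λ), IsZLattice ℝ Λ ∧
      IsTranslateOf X Λ ∧ IsFoldTiling k K (fun y : Λ => (y : Plane))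

/-!
# Five-fold translative tilings with a centrally symmetric decagon

Let `v 0, v 1, …` be the vertices of the decagon, with `v (k + 5) = -v k`, and let
`e k = v (k + 1) - v k` be the sides and `s k = v k + v (k + 1)` the vectors between the midpoints
of opposite sides. Write `m x` for the multiplicity of `x` in `X`.

Counting the translates that cover the points near a given point `y` shows
(`IsTiling.count_shift`) that the number `κ y = m (y - v k) + m (y + v k)` of translates with
vertex `v k` or `-v k` at `y` does not depend on `k`, that `2 φ + ℓ + 4 κ = 10` at `y`, where `φ`
and `ℓ` count the translates with `y` in the interior and in the relative interior of a side, and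
that along each side there are equally many translates on either side. In particular
`m x - m (x + s 0)` has the period `e 0`.

The main step (`IsTiling.mult_add_s`) is that `m` has all the periods `s k`. If
`m (x + s 0) < m x`, then the whole row `x + n e 0` consists of points of `X`. If a translate has
the vertex `v k`, `k = 2, 3, 4`, at a place `y`, then it has `y - e 0` in its interior. Hence, on
average along the row, the vertices produce `3 κ` inner points, which contradicts
`2 φ + ℓ + 4 κ = 10` because `κ ≥ 1` and `ℓ ≥ 1`. This fails only if some of the inner points
coincide. The coincidences are dealt with in the same way, up to the relations `s 2 = 2 e 0` and
`s 3 = 2 e 0` (`IsTiling.relation_of_lt`). By parity a second direction is unbalanced too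
(`IsTiling.exists_ne_of_lt`), and convexity leaves a single pair of simultaneous relations
(`relation_of_s_two`, `relation_of_s_three`), which is excluded by `IsTiling.not_two_relations`.

So `X` is a union of classes modulo the group `Λ` generated by the `s k`, which is a lattice
because `X` is locally finite. If `x` belongs to `X`, then at `y = x + v 0` the class of `x` alone
provides one vertex of each antipodal pair, and at least three inner points: for any decagon the
points `v k + v (k + 4) - v (k + 2)`, `k` even, are inner points, and at least three of the five
are different. This exhausts `2 φ + ℓ + 4 κ = 10` (`IsTiling.mult_eq_one_and_close`). As the
translates of the decagon by `Λ` cover the plane (`exists_sub_mem_region`), no point of another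
class is left.
-/

/-! ### Centred decagons -/

/-- The cross product `a ∧ b` of two plane vectors. -/
def wedge (a b : Plane) : ℝ := a 0 * b 1 - a 1 * b 0

lemma wedge_add_left (a b c : Plane) : wedge (a + b) c = wedge a c + wedge b c := by
  simp [wedge]; ring

lemma wedge_sub_left (a b c : Plane) : wedge (a - b) c = wedge a c - wedge b c := by
  simp [wedge]; ring

lemma wedge_smul_left (t : ℝ) (a b : Plane) : wedge (t • a) b = t * wedge a b := by
  simp [wedge]; ring

lemma wedge_add_right (a b c : Plane) : wedge a (b + c) = wedge a b + wedge a c := by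
  simp [wedge]; ring

lemma wedge_sub_right (a b c : Plane) : wedge a (b - c) = wedge a b - wedge a c := by
  simp [wedge]; ring

lemma wedge_smul_right (t : ℝ) (a b : Plane) : wedge a (t • b) = t * wedge a b := by
  simp [wedge]; ring

lemma wedge_neg_right (a b : Plane) : wedge a (-b) = -wedge a b := by
  simp [wedge]; ring

lemma wedge_neg_left (a b : Plane) : wedge (-a) b = -wedge a b := by
  simp [wedge]; ring

lemma wedge_anti (a b : Plane) : wedge a b = -wedge b a := by
  simp [wedge]; ring

lemma wedge_self (a : Plane) : wedge a a = 0 := by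
  simp [wedge]; ring

lemma plane_ext {a b : Plane} (h0 : a 0 = b 0) (h1 : a 1 = b 1) : a = b := by
  ext i; fin_cases i <;> assumption

/-- Cramer's rule. -/
lemma wedge_smul_eq (a b p : Plane) : wedge a b • p = wedge p b • a + wedge a p • b := by
  apply plane_ext <;> simp [wedge] <;> ring

/-- The vertices of a convex decagon centred at the origin, listed anticlockwise and continued
periodically: `v (k + 5)` is the vertex opposite to `v k`. The convexity is expressed by the
directions of the sides: within a half-turn any side points to the left of the earlier ones. -/
structure CentredDecagon where
  /-- The vertices. -/
  v : ℕ → Plane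
  antipodal : ∀ k, v (k + 5) = -v k
  turning : ∀ i j, i < j → j < i + 5 → 0 < wedge (v (i + 1) - v i) (v (j + 1) - v j)

namespace CentredDecagon

variable (D : CentredDecagon)

/-- The side from `v k` to `v (k + 1)`, as a vector. -/
def e (k : ℕ) : Plane := D.v (k + 1) - D.v k

/-- The vector from the midpoint of the side opposite to side `k` to the midpoint of side `k`. -/
def s (k : ℕ) : Plane := D.v k + D.v (k + 1)

/-- The signed distance (up to a positive factor) of `p` from the line of side `j`; it is positive
on the side of this line on which the decagon lies. -/
def gap (j : ℕ) (p : Plane) : ℝ := wedge (D.e j) (p - D.v j)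

/-- The solid decagon. -/
def region : Set Plane := {p | ∀ j, 0 ≤ D.gap j p}

/-- The open decagon. -/
def core : Set Plane := {p | ∀ j, 0 < D.gap j p}

/-- The relatively open side number `j`. -/
def side (j : ℕ) : Set Plane := {p | D.gap j p = 0 ∧ ∀ l, l % 10 ≠ j % 10 → 0 < D.gap l p}

/-- The same decagon with the vertices counted from `v a`. -/
def shift (a : ℕ) : CentredDecagon where
  v k := D.v (a + k)
  antipodal k := D.antipodal (a + k)
  turning i j h h' := D.turning (a + i) (a + j) (by omega) (by omega)

@[simp] lemma shift_v (a k : ℕ) : (D.shift a).v k = D.v (a + k) := rfl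
@[simp] lemma shift_e (a k : ℕ) : (D.shift a).e k = D.e (a + k) := rfl
@[simp] lemma shift_s (a k : ℕ) : (D.shift a).s k = D.s (a + k) := rfl
@[simp] lemma shift_gap (a k : ℕ) : (D.shift a).gap k = D.gap (a + k) := rfl

lemma e_antipodal (k : ℕ) : D.e (k + 5) = -D.e k := by
  have h := D.antipodal (k + 1)
  rw [show k + 1 + 5 = k + 5 + 1 by ring] at h
  simp only [e, h, D.antipodal k]; abel

lemma s_antipodal (k : ℕ) : D.s (k + 5) = -D.s k := by
  have h := D.antipodal (k + 1)
  rw [show k + 1 + 5 = k + 5 + 1 by ring] at h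
  simp only [s, h, D.antipodal k]; abel

lemma v_add_ten (k : ℕ) : D.v (k + 10) = D.v k := by
  rw [show k + 10 = k + 5 + 5 by ring, D.antipodal, D.antipodal, neg_neg]

lemma v_mod (k : ℕ) : D.v (k % 10) = D.v k :=
  Function.Periodic.map_mod_nat (f := D.v) (a := 10) D.v_add_ten k

lemma gap_antipodal (j : ℕ) (p : Plane) : D.gap (j + 5) p = D.gap j (-p) := by
  simp only [gap, D.e_antipodal, D.antipodal]
  simp [wedge]; ring

lemma gap_add_ten (j : ℕ) (p : Plane) : D.gap (j + 10) p = D.gap j p := by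
  rw [show j + 10 = j + 5 + 5 by ring, D.gap_antipodal, D.gap_antipodal, neg_neg]

lemma gap_mod (j : ℕ) (p : Plane) : D.gap (j % 10) p = D.gap j p :=
  Function.Periodic.map_mod_nat (f := fun j => D.gap j p) (a := 10) (fun j => D.gap_add_ten j p) j

lemma gap_congr {j l : ℕ} (h : j % 10 = l % 10) (p : Plane) : D.gap j p = D.gap l p := by
  rw [← D.gap_mod j, h, D.gap_mod]

lemma v_congr {j l : ℕ} (h : j % 10 = l % 10) : D.v j = D.v l := by
  rw [← D.v_mod j, h, D.v_mod]

lemma side_congr {j l : ℕ} (h : j % 10 = l % 10) : D.side j = D.side l := by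
  ext p; simp only [side, Set.mem_ofPred_eq, D.gap_congr h, h]

lemma region_shift (a : ℕ) : (D.shift a).region = D.region := by
  ext p
  constructor
  · intro h j
    have := h (j + 9 * a)
    rwa [shift_gap, D.gap_congr (l := j) (by omega)] at this
  · intro h j
    exact h _

lemma core_shift (a : ℕ) : (D.shift a).core = D.core := by
  ext p
  constructor
  · intro h j
    have := h (j + 9 * a)
    rwa [shift_gap, D.gap_congr (l := j) (by omega)] at this
  · intro h j
    exact h _

lemma side_shift (a j : ℕ) : (D.shift a).side j = D.side (a + j) := by
  ext p
  constructor
  · rintro ⟨h, h'⟩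
    refine ⟨h, fun l hl => ?_⟩
    have := h' (l + 9 * a) (by omega)
    rwa [shift_gap, D.gap_congr (l := l) (by omega)] at this
  · rintro ⟨h, h'⟩
    exact ⟨h, fun l hl => h' (a + l) (by omega)⟩

/-- Only five sides have to be tested, if `p` and `-p` are tested together. -/
lemma mem_core_of_lt_five {p : Plane} (h : ∀ j < 5, 0 < D.gap j p ∧ 0 < D.gap j (-p)) :
    p ∈ D.core := by
  intro j
  rw [← D.gap_mod]
  rcases lt_or_ge (j % 10) 5 with hj | hj
  · exact (h _ hj).1
  · obtain ⟨l, hl⟩ := Nat.exists_eq_add_of_le' hj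
    rw [hl, D.gap_antipodal]
    exact (h l (by omega)).2

lemma neg_mem_core {p : Plane} (h : p ∈ D.core) : -p ∈ D.core := fun j => by
  rw [← D.gap_antipodal]; exact h _

lemma neg_mem_region {p : Plane} (h : p ∈ D.region) : -p ∈ D.region := fun j => by
  rw [← D.gap_antipodal]; exact h _

lemma core_subset_region : D.core ⊆ D.region := fun _ h j => (h j).le

lemma wedge_e_pos {i j : ℕ} (h : i < j) (h' : j < i + 5) : 0 < wedge (D.e i) (D.e j) :=
  D.turning i j h h'

lemma e_succ_sub (k : ℕ) : D.v (k + 1) = D.v k + D.e k := by simp [e]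

/-- The centre is the midpoint of opposite vertices, so half the boundary leads from `v 0` to its
antipode. -/
lemma v_zero : D.v 0 = (-(1 / 2) : ℝ) • (D.e 0 + D.e 1 + D.e 2 + D.e 3 + D.e 4) := by
  have h := D.antipodal 0
  have : D.e 0 + D.e 1 + D.e 2 + D.e 3 + D.e 4 = D.v 5 - D.v 0 := by simp only [e]; abel
  rw [this, show D.v 5 = -D.v 0 from h]
  module

/-- All wedge products of two of the five sides `e 0, …, e 4`. -/
lemma turning_all : 0 < wedge (D.e 0) (D.e 1) ∧ 0 < wedge (D.e 0) (D.e 2) ∧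
    0 < wedge (D.e 0) (D.e 3) ∧ 0 < wedge (D.e 0) (D.e 4) ∧ 0 < wedge (D.e 1) (D.e 2) ∧
    0 < wedge (D.e 1) (D.e 3) ∧ 0 < wedge (D.e 1) (D.e 4) ∧ 0 < wedge (D.e 2) (D.e 3) ∧
    0 < wedge (D.e 2) (D.e 4) ∧ 0 < wedge (D.e 3) (D.e 4) := by
  refine ⟨?_, ?_, ?_, ?_, ?_, ?_, ?_, ?_, ?_, ?_⟩ <;> exact D.wedge_e_pos (by omega) (by omega)

lemma v_one : D.v 1 = D.v 0 + D.e 0 := D.e_succ_sub 0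
lemma v_two : D.v 2 = D.v 0 + D.e 0 + D.e 1 := by rw [D.e_succ_sub 1, v_one]
lemma v_three : D.v 3 = D.v 0 + D.e 0 + D.e 1 + D.e 2 := by rw [D.e_succ_sub 2, v_two]
lemma v_four : D.v 4 = D.v 0 + D.e 0 + D.e 1 + D.e 2 + D.e 3 := by rw [D.e_succ_sub 3, v_three]
lemma v_five : D.v 5 = -D.v 0 := D.antipodal 0

/-- The antisymmetry of the cross product, as rewrite rules that put indices into order. -/
lemma wedge_e_anti : wedge (D.e 1) (D.e 0) = -wedge (D.e 0) (D.e 1) ∧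
    wedge (D.e 2) (D.e 0) = -wedge (D.e 0) (D.e 2) ∧
    wedge (D.e 3) (D.e 0) = -wedge (D.e 0) (D.e 3) ∧
    wedge (D.e 4) (D.e 0) = -wedge (D.e 0) (D.e 4) ∧
    wedge (D.e 2) (D.e 1) = -wedge (D.e 1) (D.e 2) ∧
    wedge (D.e 3) (D.e 1) = -wedge (D.e 1) (D.e 3) ∧
    wedge (D.e 4) (D.e 1) = -wedge (D.e 1) (D.e 4) ∧
    wedge (D.e 3) (D.e 2) = -wedge (D.e 2) (D.e 3) ∧
    wedge (D.e 4) (D.e 2) = -wedge (D.e 2) (D.e 4) ∧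
    wedge (D.e 4) (D.e 3) = -wedge (D.e 3) (D.e 4) := by
  refine ⟨?_, ?_, ?_, ?_, ?_, ?_, ?_, ?_, ?_, ?_⟩ <;> exact wedge_anti _ _

/-- Moving from the vertex `v k`, `k = 2, 3, 4`, by the side vector `-e 0` leads into the
interior. -/
lemma v_sub_e_mem_core {k : ℕ} (h2 : 2 ≤ k) (h4 : k ≤ 4) : D.v k - D.e 0 ∈ D.core := by
  obtain ⟨h01, h02, h03, h04, h12, h13, h14, h23, h24, h34⟩ := D.turning_all
  apply D.mem_core_of_lt_five
  intro j hj
  interval_cases k <;> interval_cases j <;>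
    simp only [gap, v_one, v_two, v_three, v_four, v_zero, wedge_add_right, wedge_sub_right,
      wedge_smul_right, wedge_neg_right, wedge_self, D.wedge_e_anti] <;> constructor <;> linarith

lemma e_sub_v_four_mem_core : D.e 2 - D.v 4 ∈ D.core := by
  obtain ⟨h01, h02, h03, h04, h12, h13, h14, h23, h24, h34⟩ := D.turning_all
  apply D.mem_core_of_lt_five
  intro j hj
  interval_cases j <;>
    simp only [gap, v_one, v_two, v_three, v_four, v_zero, wedge_add_right, wedge_sub_right,
      wedge_smul_right, wedge_neg_right, wedge_self, D.wedge_e_anti] <;> constructor <;> linarith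

/-- The fourth vertex of the parallelogram spanned by three vertices of the decagon, every second
one taken, lies in the interior. -/
lemma parallelogram_mem_core : D.v 0 + D.v 4 - D.v 2 ∈ D.core := by
  obtain ⟨h01, h02, h03, h04, h12, h13, h14, h23, h24, h34⟩ := D.turning_all
  apply D.mem_core_of_lt_five
  intro j hj
  interval_cases j <;>
    simp only [gap, v_one, v_two, v_three, v_four, v_zero, wedge_add_right, wedge_sub_right,
      wedge_smul_right, wedge_neg_right, wedge_self, D.wedge_e_anti] <;> constructor <;> linarith

lemma zero_mem_core : (0 : Plane) ∈ D.core := by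
  obtain ⟨h01, h02, h03, h04, h12, h13, h14, h23, h24, h34⟩ := D.turning_all
  apply D.mem_core_of_lt_five
  intro j hj
  interval_cases j <;>
    simp only [gap, v_one, v_two, v_three, v_four, v_zero, neg_zero, zero_sub,
      wedge_add_right, wedge_smul_right, wedge_neg_right, wedge_self, D.wedge_e_anti] <;>
    constructor <;> linarith

lemma gap_v_self (l : ℕ) : D.gap l (D.v l) = 0 := by simp [gap, wedge]

lemma gap_v_succ (l : ℕ) : D.gap l (D.v (l + 1)) = 0 := by
  rw [gap, ← e, wedge_self]

lemma gap_v_pos (l : ℕ) {k : ℕ} (h2 : 2 ≤ k) (h9 : k ≤ 9) : 0 < D.gap l (D.v (l + k)) := by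
  suffices H : ∀ D : CentredDecagon, 0 < D.gap 0 (D.v k) from H (D.shift l)
  intro D
  obtain ⟨h01, h02, h03, h04, h12, h13, h14, h23, h24, h34⟩ := D.turning_all
  have h6 := D.antipodal 1
  have h7 := D.antipodal 2
  have h8 := D.antipodal 3
  have h10 := D.antipodal 4
  norm_num at h6 h7 h8 h10
  interval_cases k <;>
    simp only [gap, h6, h7, h8, h10, v_five, v_one, v_two, v_three, v_four, v_zero, wedge_sub_right,
      wedge_add_right, wedge_smul_right, wedge_neg_right, wedge_self] <;>
    linarith

lemma gap_v_pos_of_mod {l k : ℕ} (h : k % 10 ≠ l % 10) (h' : k % 10 ≠ (l + 1) % 10) :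
    0 < D.gap l (D.v k) := by
  have := D.gap_v_pos l (k := (k % 10 + 10 - l % 10) % 10) (by omega) (by omega)
  rwa [D.v_congr (l := k) (by omega)] at this

lemma v_mem_region (k : ℕ) : D.v k ∈ D.region := by
  intro l
  by_cases h : k % 10 = l % 10
  · rw [D.v_congr h, gap_v_self]
  by_cases h' : k % 10 = (l + 1) % 10
  · rw [D.v_congr h', gap_v_succ]
  exact (D.gap_v_pos_of_mod h h').le

lemma e_ne (k : ℕ) {j : ℕ} (h1 : 1 ≤ j) (h4 : j ≤ 4) : D.e (k + j) ≠ D.e k := fun h => by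
  have := D.wedge_e_pos (i := k) (j := k + j) (by omega) (by omega)
  rw [h, wedge_self] at this
  exact this.false

lemma v_ne {j k : ℕ} (h : j % 10 ≠ k % 10) : D.v j ≠ D.v k := fun H => by
  by_cases h' : j % 10 = (k + 1) % 10
  · have := D.gap_v_pos_of_mod (k := k) (l := j) (Ne.symm h) (by omega)
    rw [← H, gap_v_self] at this
    exact this.false
  · have := D.gap_v_pos_of_mod h h'
    rw [H, gap_v_self] at this
    exact this.false

/-- A point of the decagon on the line of side `j` belongs to side `j`. -/
lemma exists_of_gap_eq_zero {p : Plane} (hp : p ∈ D.region) {j : ℕ} (hj : D.gap j p = 0) :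
    ∃ t : ℝ, 0 ≤ t ∧ t ≤ 1 ∧ p = D.v j + t • D.e j := by
  suffices H : ∀ D : CentredDecagon, p ∈ D.region → D.gap 0 p = 0 →
      ∃ t : ℝ, 0 ≤ t ∧ t ≤ 1 ∧ p = D.v 0 + t • D.e 0 from
    H (D.shift j) (by rwa [region_shift]) (by simpa using hj)
  clear hj hp
  intro D hp hj
  obtain ⟨h01, h02, h03, h04, h12, h13, h14, h23, h24, h34⟩ := D.turning_all
  have hc := wedge_smul_eq (D.e 0) (D.e 1) (p - D.v 0)
  have hz : wedge (D.e 0) (p - D.v 0) = 0 := hj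
  rw [hz, zero_smul, add_zero] at hc
  set t := wedge (p - D.v 0) (D.e 1) / wedge (D.e 0) (D.e 1) with ht
  have hpt : p = D.v 0 + t • D.e 0 := by
    rw [ht, div_eq_inv_mul, mul_smul, ← hc, smul_smul, inv_mul_cancel₀ h01.ne', one_smul]
    abel
  refine ⟨t, ?_, ?_, hpt⟩
  · have h := D.gap_antipodal 4 p ▸ hp 9
    simp only [hpt, gap, v_four, v_zero, wedge_sub_right, wedge_add_right, wedge_smul_right,
      wedge_neg_right, wedge_self, D.wedge_e_anti] at h
    nlinarith
  · have h := hp 1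
    simp only [hpt, gap, v_one, wedge_sub_right, wedge_add_right, wedge_smul_right,
      D.wedge_e_anti] at h
    nlinarith

lemma gap_combination (l j : ℕ) (t : ℝ) :
    D.gap l (D.v j + t • D.e j) = (1 - t) * D.gap l (D.v j) + t * D.gap l (D.v (j + 1)) := by
  simp only [gap, e, wedge_sub_right, wedge_add_right, wedge_smul_right]; ring

/-- A point of the decagon is an inner point, or an inner point of a side, or a vertex. -/
lemma mem_core_or_side_or_vertex {p : Plane} (hp : p ∈ D.region) :
    p ∈ D.core ∨ (∃ j < 10, p ∈ D.side j) ∨ ∃ j < 10, p = D.v j := by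
  by_cases hc : p ∈ D.core
  · exact .inl hc
  right
  simp only [core, Set.mem_ofPred_eq, not_forall, not_lt] at hc
  obtain ⟨j, hj⟩ := hc
  have hj0 := le_antisymm hj (hp j)
  obtain ⟨t, h0, h1, rfl⟩ := D.exists_of_gap_eq_zero hp hj0
  rcases h0.eq_or_lt with rfl | h0
  · exact .inr ⟨j % 10, Nat.mod_lt _ (by norm_num), by simp [v_mod]⟩
  rcases h1.eq_or_lt with rfl | h1
  · exact .inr ⟨(j + 1) % 10, Nat.mod_lt _ (by norm_num), by simp [v_mod, e]⟩
  refine .inl ⟨j % 10, Nat.mod_lt _ (by norm_num), by rw [gap_mod, hj0], fun l hl => ?_⟩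
  rw [Nat.mod_mod] at hl
  rw [gap_combination]
  have ha := D.v_mem_region j l
  have hb := D.v_mem_region (j + 1) l
  by_cases h' : j % 10 = (l + 1) % 10
  · have := D.gap_v_pos_of_mod (k := j + 1) (l := l) (by omega) (by omega)
    have : 0 < t * D.gap l (D.v (j + 1)) := mul_pos h0 this
    have : 0 ≤ (1 - t) * D.gap l (D.v j) := mul_nonneg (by linarith) ha
    linarith
  · have := D.gap_v_pos_of_mod (k := j) (l := l) (by omega) h'
    have : 0 < (1 - t) * D.gap l (D.v j) := mul_pos (by linarith) this
    have : 0 ≤ t * D.gap l (D.v (j + 1)) := mul_nonneg h0.le hb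
    linarith

lemma isBounded_region : Bornology.IsBounded D.region := by
  obtain ⟨h01, -⟩ := D.turning_all
  set a := D.e 0
  set b := D.e 1
  have key : ∀ p ∈ D.region, |wedge a p| ≤ |wedge a (D.v 0)| ∧ |wedge b p| ≤ |wedge b (D.v 1)| := by
    intro p hp
    have h0 := hp 0
    have h1 := hp 1
    have h5 := D.neg_mem_region hp 0
    have h6 := D.neg_mem_region hp 1
    simp only [gap, wedge_sub_right, wedge_neg_right] at h0 h1 h5 h6
    constructor <;> rw [abs_le]
    · constructor <;> linarith [neg_abs_le (wedge a (D.v 0)), le_abs_self (wedge a (D.v 0)),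
        neg_le_abs (wedge a (D.v 0))]
    · constructor <;> linarith [neg_abs_le (wedge b (D.v 1)), le_abs_self (wedge b (D.v 1)),
        neg_le_abs (wedge b (D.v 1))]
  refine isBounded_iff_forall_norm_le.2
    ⟨(wedge a b)⁻¹ * (|wedge b (D.v 1)| * ‖a‖ + |wedge a (D.v 0)| * ‖b‖), fun p hp => ?_⟩
  obtain ⟨ha, hb⟩ := key p hp
  have hpe : p = (wedge a b)⁻¹ • (wedge p b • a + wedge a p • b) := by
    rw [← wedge_smul_eq, smul_smul, inv_mul_cancel₀ h01.ne', one_smul]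
  rw [hpe, norm_smul, norm_inv, Real.norm_of_nonneg h01.le]
  refine mul_le_mul_of_nonneg_left ((norm_add_le _ _).trans ?_) (inv_nonneg.2 h01.le)
  rw [norm_smul, norm_smul, wedge_anti p b, norm_neg]
  gcongr
  · exact hb
  · exact ha

end CentredDecagon

/-! ### Centrally symmetric convex cycles -/

lemma orient_eq_wedge (a b c : Plane) : orient a b c = wedge (b - a) (c - a) := by
  simp [orient, wedge]

lemma orient_rotate (a b c : Plane) : orient b c a = orient a b c := by
  simp [orient]; ring

lemma orient_swap (a b c : Plane) : orient a c b = -orient a b c := by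
  simp [orient]; ring

lemma orient_left_self (a b : Plane) : orient a b a = 0 := by
  simp [orient]

lemma orient_right_self (a b : Plane) : orient a b b = 0 := by
  simp [orient]; ring

lemma orient_neg (a b c : Plane) : orient (-a) (-b) c = orient a b (-c) := by
  simp [orient]; ring

lemma orient_combination (a b p q : Plane) {x y : ℝ} (h : x + y = 1) :
    orient a b (x • p + y • q) = x * orient a b p + y * orient a b q := by
  obtain rfl : x = 1 - y := by linarith
  simp [orient]; ring

lemma convex_orient_nonneg (a b : Plane) : Convex ℝ {p | 0 ≤ orient a b p} := by
  intro p hp q hq x y hx hy h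
  simp only [Set.mem_ofPred_eq] at *
  rw [orient_combination a b p q h]
  positivity

lemma eq_zero_of_eq_neg {a : Plane} (h : a = -a) : a = 0 := by
  have h0 := congrArg (fun p : Plane => p 0) h
  have h1 := congrArg (fun p : Plane => p 1) h
  simp only [PiLp.neg_apply] at h0 h1
  apply plane_ext <;> simp only [PiLp.zero_apply] <;> linarith

/-- Barycentric coordinates. -/
lemma orient_smul_eq (a b c p : Plane) :
    orient a b c • p = orient b c p • a + orient c a p • b + orient a b p • c := by
  apply plane_ext <;> simp [orient] <;> ring

/-- The sign of the cross product of a direction `f` with the middle one of three consecutive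
steps `a`, `b`, `c` around a convex quadrilateral, if the first step, the third step and the sum
of the steps point to the left of `f`. -/
lemma wedge_middle_pos {f a b c : Plane} (ha : 0 < wedge f a) (hc : 0 < wedge f c)
    (hs : 0 < wedge f (a + b + c)) (hab : 0 < wedge a b) (hbc : 0 < wedge b c)
    (h1 : 0 < wedge a (b + c)) (h2 : 0 < wedge (a + b) c) : 0 < wedge f b := by
  rw [wedge_add_right, wedge_add_right] at hs
  rw [wedge_add_right] at h1
  rw [wedge_add_left] at h2
  by_contra! hb
  have p1 : wedge f a * wedge b c - wedge f b * wedge a c + wedge f c * wedge a b = 0 := by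
    simp only [wedge]; ring
  have hac : wedge a c < 0 := by
    by_contra! hac
    nlinarith [mul_pos ha hbc, mul_pos hc hab, mul_nonneg (neg_nonneg.2 hb) hac]
  nlinarith [mul_pos ha h2, mul_pos hc h1, mul_pos hs (neg_pos.2 hac)]

/-- A cyclic list of ten points in convex position. -/
structure IsConvexCycle (w : ℕ → Plane) : Prop where
  periodic : ∀ k, w (k + 10) = w k
  orient_pos : ∀ i j k, i < j → j < k → k < i + 10 → 0 < orient (w i) (w j) (w k)

namespace IsConvexCycle

lemma of_fin {v : Fin 10 → Plane}
    (h : ∀ i j k : Fin 10, i < j → j < k → 0 < orient (v i) (v j) (v k)) :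
    IsConvexCycle (fun k => v (Fin.ofNat 10 k)) := by
  refine ⟨fun k => by congr 1; apply Fin.ext; simp, fun i j k hij hjk hki => ?_⟩
  have key : ∀ a b c : ℕ, a % 10 < b % 10 → b % 10 < c % 10 →
      0 < orient (v (Fin.ofNat 10 a)) (v (Fin.ofNat 10 b)) (v (Fin.ofNat 10 c)) :=
    fun a b c hab hbc => h _ _ _ (by simpa [Fin.lt_def] using hab) (by simpa [Fin.lt_def] using hbc)
  rcases (by omega : (i % 10 < j % 10 ∧ j % 10 < k % 10) ∨ (j % 10 < k % 10 ∧ k % 10 < i % 10) ∨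
    (k % 10 < i % 10 ∧ i % 10 < j % 10)) with ⟨h1, h2⟩ | ⟨h1, h2⟩ | ⟨h1, h2⟩
  · exact key _ _ _ h1 h2
  · rw [← orient_rotate]; exact key _ _ _ h1 h2
  · rw [orient_rotate]; exact key _ _ _ h1 h2

variable {w : ℕ → Plane} (hw : IsConvexCycle w)
include hw

lemma mod (k : ℕ) : w (k % 10) = w k :=
  Function.Periodic.map_mod_nat (f := w) (a := 10) hw.periodic k

lemma congr {j k : ℕ} (h : j % 10 = k % 10) : w j = w k := by
  rw [← hw.mod j, h, hw.mod]

lemma side_orient_pos {j k : ℕ} (h : k % 10 ≠ j % 10) (h' : k % 10 ≠ (j + 1) % 10) :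
    0 < orient (w j) (w (j + 1)) (w k) := by
  have := hw.orient_pos j (j + 1) (j + (k % 10 + 10 - j % 10) % 10) (by omega) (by omega) (by omega)
  rwa [hw.congr (j := _ + _ % 10) (k := k) (by omega)] at this

lemma side_orient_nonneg (j k : ℕ) : 0 ≤ orient (w j) (w (j + 1)) (w k) := by
  by_cases h : k % 10 = j % 10
  · rw [hw.congr h, orient_left_self]
  by_cases h' : k % 10 = (j + 1) % 10
  · rw [hw.congr h', orient_right_self]
  exact (hw.side_orient_pos h h').le

lemma ne_succ (j : ℕ) : w j ≠ w (j + 1) := fun h => by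
  have := hw.orient_pos j (j + 1) (j + 2) (by omega) (by omega) (by omega)
  simp [h, orient] at this

/-- The convex hull of a convex cycle is the intersection of the half-planes of its sides: a point
of the intersection lies in one of the triangles with apex `w 0` that make up the polygon. -/
lemma convexHull_eq : convexHull ℝ (Set.range w) =
    {p | ∀ j, 0 ≤ orient (w j) (w (j + 1)) p} := by
  apply Set.Subset.antisymm
  · refine convexHull_min ?_ ?_
    · rintro _ ⟨k, rfl⟩ j
      exact hw.side_orient_nonneg j k
    · rw [show {p | ∀ j, 0 ≤ orient (w j) (w (j + 1)) p} =
        ⋂ j, {p | 0 ≤ orient (w j) (w (j + 1)) p} by ext; simp]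
      exact convex_iInter fun j => convex_orient_nonneg _ _
  · intro p hp
    have hex : ∃ k, orient (w 0) (w (k + 2)) p ≤ 0 := by
      refine ⟨7, ?_⟩
      have h := hp 9
      rw [show w (9 + 1) = w 0 from hw.periodic 0] at h
      have : orient (w 0) (w 9) p = -orient (w 9) (w 0) p := by simp [orient]; ring
      simpa [this] using h
    classical
    obtain ⟨k, hk, hmin⟩ : ∃ k, orient (w 0) (w (k + 2)) p ≤ 0 ∧
        ∀ l < k, 0 < orient (w 0) (w (l + 2)) p :=
      ⟨Nat.find hex, Nat.find_spec hex, fun l hl => not_le.1 (Nat.find_min hex hl)⟩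
    have hk7 : k ≤ 7 := by
      by_contra! h
      have h1 := hmin 7 h
      have h := hp 9
      rw [show w (9 + 1) = w 0 from hw.periodic 0] at h
      have : orient (w 0) (w 9) p = -orient (w 9) (w 0) p := by simp [orient]; ring
      norm_num [this] at h1
      linarith
    have h0 : 0 ≤ orient (w 0) (w (k + 1)) p := by
      rcases k with _ | k
      · exact hp 0
      · exact (hmin k (by omega)).le
    have hpos := hw.orient_pos 0 (k + 1) (k + 2) (by omega) (by omega) (by omega)
    have h1 := hp (k + 1)
    have h2 : 0 ≤ orient (w (k + 2)) (w 0) p := by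
      have : orient (w (k + 2)) (w 0) p = -orient (w 0) (w (k + 2)) p := by simp [orient]; ring
      linarith
    have hb := orient_smul_eq (w 0) (w (k + 1)) (w (k + 2)) p
    have hsum : orient (w (k + 1)) (w (k + 2)) p + orient (w (k + 2)) (w 0) p +
        orient (w 0) (w (k + 1)) p = orient (w 0) (w (k + 1)) (w (k + 2)) := by
      simp [orient]; ring
    set d := orient (w 0) (w (k + 1)) (w (k + 2))
    have hpe : p = (orient (w (k + 1)) (w (k + 2)) p / d) • w 0 +
        (orient (w (k + 2)) (w 0) p / d) • w (k + 1) +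
        (orient (w 0) (w (k + 1)) p / d) • w (k + 2) := by
      simp only [div_eq_inv_mul, mul_smul, ← smul_add]
      rw [← hb, smul_smul, inv_mul_cancel₀ hpos.ne', one_smul]
    rw [hpe]
    have hmem := (convex_convexHull ℝ (Set.range w)).sum_mem (t := Finset.univ)
      (w := ![orient (w (k + 1)) (w (k + 2)) p / d, orient (w (k + 2)) (w 0) p / d,
        orient (w 0) (w (k + 1)) p / d]) (z := ![w 0, w (k + 1), w (k + 2)])
      (by intro i _; fin_cases i <;> simp <;> positivity)
      (by simp only [Fin.sum_univ_three, Matrix.cons_val]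
          rw [← add_div, ← add_div, hsum, div_self hpos.ne'])
      (by intro i _; fin_cases i <;> exact subset_convexHull ℝ _ (Set.mem_range_self _))
    simpa [Fin.sum_univ_three] using hmem

/-- A vertex is not an inner point of a segment in the polygon, because it is the only common
point of the two sides at which it lies. -/
lemma eq_of_mem_openSegment {p q : Plane} (hp : p ∈ convexHull ℝ (Set.range w))
    (hq : q ∈ convexHull ℝ (Set.range w)) {k : ℕ} (h : w k ∈ openSegment ℝ p q) : p = w k := by
  rw [hw.convexHull_eq] at hp hq
  obtain ⟨x, y, hx, hy, hxy, hk⟩ := h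
  have key : ∀ j, orient (w j) (w (j + 1)) (w k) = 0 → orient (w j) (w (j + 1)) p = 0 := by
    intro j hj
    rw [← hk, orient_combination _ _ _ _ hxy] at hj
    have h1 := hp j
    have h2 := mul_nonneg hy.le (hq j)
    nlinarith [mul_nonneg hx.le h1]
  have h1 := key k (orient_left_self _ _)
  have h2 := key (k + 9) (by rw [show w (k + 9 + 1) = w k from hw.periodic k, orient_right_self])
  rw [show w (k + 9 + 1) = w k from hw.periodic k] at h2
  have hpos := hw.orient_pos k (k + 1) (k + 9) (by omega) (by omega) (by omega)
  have hc := wedge_smul_eq (w (k + 1) - w k) (w (k + 9) - w k) (p - w k)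
  rw [orient_eq_wedge] at h1 hpos
  have h2' : wedge (p - w k) (w (k + 9) - w k) = 0 := by
    rw [← h2]; simp [wedge, orient]; ring
  rw [h1, h2', zero_smul, zero_smul, add_zero, smul_eq_zero_iff_right hpos.ne'] at hc
  exact sub_eq_zero.1 hc

section Symmetric

variable (hs : ∀ p ∈ convexHull ℝ (Set.range w), -p ∈ convexHull ℝ (Set.range w))
include hs

/-- In a centrally symmetric cycle the antipode of a vertex is a vertex. -/
lemma exists_antipode (k : ℕ) : ∃ j, w j = -w k := by
  refine extremePoints_convexHull_subset (𝕜 := ℝ) (A := Set.range w) ?_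
  refine mem_extremePoints_iff_left.2
    ⟨hs _ (subset_convexHull ℝ _ (Set.mem_range_self k)), fun p hp q hq h => ?_⟩
  obtain ⟨x, y, hx, hy, hxy, hk⟩ := h
  rw [← hw.eq_of_mem_openSegment (hs p hp) (hs q hq) (k := k)
    ⟨x, y, hx, hy, hxy, by rw [smul_neg, smul_neg, ← neg_add, hk, neg_neg]⟩, neg_neg]

/-- The antipodal map is compatible with the cyclic order, because it maps sides to sides. -/
lemma antipode_succ {j k : ℕ} (h : w j = -w k) : w (j + 1) = -w (k + 1) := by
  obtain ⟨b, hb⟩ := hw.exists_antipode hs (k + 1)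
  have hside : ∀ i, 0 ≤ orient (w j) (w b) (w i) := by
    intro i
    obtain ⟨l, hl⟩ := hw.exists_antipode hs i
    rw [h, hb, orient_neg, ← hl]
    exact hw.side_orient_nonneg k l
  have hne : b % 10 ≠ j % 10 := by
    intro h'
    rw [hw.congr h', h, neg_inj] at hb
    exact hw.ne_succ k hb
  by_contra hcon
  rw [← hb] at hcon
  have hb1 : b % 10 ≠ (j + 1) % 10 := fun h' => hcon (hw.congr h').symm
  have h1 := hw.side_orient_pos hne hb1
  have h2 := hside (j + 1)
  rw [orient_swap] at h2
  linarith

lemma antipodal (k : ℕ) : w (k + 5) = -w k := by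
  obtain ⟨a, ha⟩ := hw.exists_antipode hs 0
  have hall : ∀ k, w (a + k) = -w k := by
    intro k
    induction k with
    | zero => exact ha
    | succ k ih => exact hw.antipode_succ hs ih
  -- The antipodal map is the rotation by `a` places, and it is an involution.
  have h2 : ∀ k, w (2 * a + k) = w k := fun k => by
    rw [two_mul, add_assoc, hall, hall, neg_neg]
  have hinj : ∀ {i j : ℕ}, w i = w j → i % 10 = j % 10 := by
    intro i j hij
    by_contra hne
    by_cases h' : j % 10 = (i + 1) % 10
    · exact hw.ne_succ i (hij.trans (hw.congr h'))
    · have := hw.side_orient_pos (j := i) (k := j) (Ne.symm hne) h'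
      rw [← hij, orient_left_self] at this
      exact this.false
  have h5 := hinj (h2 0)
  have h0 : a % 10 ≠ 0 := by
    intro h
    have e0 := hall 0
    have e1 := hall 1
    rw [hw.congr (k := 0) (by omega)] at e0
    rw [hw.congr (k := 1) (by omega)] at e1
    exact hw.ne_succ 0 ((eq_zero_of_eq_neg e0).trans (eq_zero_of_eq_neg e1).symm)
  rw [← hall, hw.congr]
  omega

/-- The sides of a centrally symmetric cycle turn to the left within a half-turn. -/
lemma wedge_side_pos {i j : ℕ} (h : i < j) (h' : j < i + 5) :
    0 < wedge (w (i + 1) - w i) (w (j + 1) - w j) := by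
  have ha := hw.antipodal hs
  have orient_wedge : ∀ a b c : Plane, orient a b c = wedge (b - a) (c - b) := fun a b c => by
    simp [orient, wedge]; ring
  have consecutive : ∀ i, 0 < wedge (w (i + 1) - w i) (w (i + 2) - w (i + 1)) := fun i => by
    rw [← orient_wedge]; exact hw.orient_pos _ _ _ (by omega) (by omega) (by omega)
  -- The vertices strictly between side `i` and the opposite side lie strictly between their lines.
  have low : ∀ k, i + 1 < k → k < i + 6 → 0 < wedge (w (i + 1) - w i) (w k - w (i + 1)) :=
    fun k h1 h2 => by
      rw [← orient_wedge]; exact hw.orient_pos _ _ _ (by omega) (by omega) (by omega)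
  have high : ∀ k, i < k → k < i + 5 → 0 < wedge (w (i + 1) - w i) (w (i + 5) - w k) :=
    fun k h1 h2 => by
      have := hw.orient_pos i (i + 1) (k + 5) (by omega) (by omega) (by omega)
      rw [ha, orient_eq_wedge] at this
      rw [ha, show -w i - w k = -w k - w i by abel]; exact this
  obtain rfl | rfl | rfl | rfl : j = i + 1 ∨ j = i + 2 ∨ j = i + 3 ∨ j = i + 4 := by omega
  · exact consecutive i
  · refine wedge_middle_pos (a := w (i + 2) - w (i + 1)) (c := w (i + 5) - w (i + 3))
      (consecutive i) (high _ (by omega) (by omega)) ?_ (consecutive _) ?_ ?_ ?_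
    · convert high (i + 1) (by omega) (by omega) using 2; abel
    · rw [← orient_wedge]; exact hw.orient_pos _ _ _ (by omega) (by omega) (by omega)
    · rw [show w (i + 2 + 1) - w (i + 2) + (w (i + 5) - w (i + 3)) = w (i + 5) - w (i + 2) by
        rw [show i + 2 + 1 = i + 3 by ring]; abel, ← orient_wedge]
      exact hw.orient_pos _ _ _ (by omega) (by omega) (by omega)
    · rw [show w (i + 2) - w (i + 1) + (w (i + 2 + 1) - w (i + 2)) = w (i + 3) - w (i + 1) by
        rw [show i + 2 + 1 = i + 3 by ring]; abel, ← orient_wedge]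
      exact hw.orient_pos _ _ _ (by omega) (by omega) (by omega)
  · refine wedge_middle_pos (a := w (i + 3) - w (i + 1)) (c := w (i + 5) - w (i + 4))
      (low _ (by omega) (by omega)) (high _ (by omega) (by omega)) ?_ ?_ (consecutive _) ?_ ?_
    · convert high (i + 1) (by omega) (by omega) using 2; abel
    · rw [← orient_wedge]; exact hw.orient_pos _ _ _ (by omega) (by omega) (by omega)
    · rw [show w (i + 3 + 1) - w (i + 3) + (w (i + 5) - w (i + 4)) = w (i + 5) - w (i + 3) by
        rw [show i + 3 + 1 = i + 4 by ring]; abel, ← orient_wedge]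
      exact hw.orient_pos _ _ _ (by omega) (by omega) (by omega)
    · rw [show w (i + 3) - w (i + 1) + (w (i + 3 + 1) - w (i + 3)) = w (i + 4) - w (i + 1) by
        rw [show i + 3 + 1 = i + 4 by ring]; abel, ← orient_wedge]
      exact hw.orient_pos _ _ _ (by omega) (by omega) (by omega)
  · have := high (i + 4) (by omega) (by omega)
    exact this

end Symmetric

end IsConvexCycle

lemma CentredDecagon.isOpen_core (D : CentredDecagon) : IsOpen D.core := by
  have : D.core = ⋂ j ∈ Finset.range 10, {p | 0 < D.gap j p} := by
    ext p
    simp only [CentredDecagon.core, Set.mem_ofPred_eq, Set.mem_iInter, Finset.mem_range]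
    exact ⟨fun h j _ => h j, fun h j => D.gap_mod j p ▸ h (j % 10) (Nat.mod_lt _ (by norm_num))⟩
  rw [this]
  refine isOpen_biInter_finset fun j _ => isOpen_lt continuous_const ?_
  unfold CentredDecagon.gap wedge
  fun_prop

/-- A centrally symmetric convex decagon is a `CentredDecagon`. -/
theorem exists_centredDecagon {P : Set Plane} (hP : IsConvexPolygon 10 P)
    (hs : IsCentredSymmetric P) : ∃ D : CentredDecagon, P = D.region := by
  obtain ⟨-, v, hv, rfl⟩ := hP
  set w : ℕ → Plane := fun k => v (Fin.ofNat 10 k) with hwdef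
  have hw : IsConvexCycle w := .of_fin hv
  have hr : Set.range v = Set.range w := by
    apply Set.Subset.antisymm
    · rintro _ ⟨i, rfl⟩
      exact ⟨i, by simp [hwdef]⟩
    · rintro _ ⟨k, rfl⟩
      exact ⟨_, rfl⟩
  rw [hr] at hs ⊢
  refine ⟨⟨w, hw.antipodal hs, fun i j => hw.wedge_side_pos hs⟩, ?_⟩
  rw [hw.convexHull_eq]
  ext p
  simp only [CentredDecagon.region, CentredDecagon.gap, CentredDecagon.e, orient_eq_wedge]

/-! ### The local structure of a five-fold tiling -/

open Filter Topology

/-- The number of members `x` of the multiset `X` with `y - x ∈ A`. -/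
noncomputable def count {ι : Type*} (X : ι → Plane) (A : Set Plane) (y : Plane) : ℕ :=
  {i | y - X i ∈ A}.ncard

/-- The multiplicity of `x` in the multiset `X`. -/
noncomputable def mult {ι : Type*} (X : ι → Plane) (x : Plane) : ℕ := {i | X i = x}.ncard

lemma exists_index_of_mult_pos {ι : Type*} {X : ι → Plane} {x : Plane} (h : 1 ≤ mult X x) :
    ∃ i, X i = x :=
  Set.nonempty_of_ncard_ne_zero (s := {i | X i = x}) (Nat.one_le_iff_ne_zero.1 h)

namespace CentredDecagon

variable (D : CentredDecagon)

lemma e_congr {j l : ℕ} (h : j % 10 = l % 10) : D.e j = D.e l := by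
  rw [e, e, D.v_congr h, D.v_congr (j := j + 1) (l := l + 1) (by omega)]

/-- A direction that is not parallel to any side and lies between the sides `e 4` and `e 5`. -/
def generic : Plane := D.e 4 - D.e 0

lemma wedge_generic_pos {j : ℕ} (h : j % 10 < 5) : 0 < wedge (D.e j) D.generic := by
  obtain ⟨h01, h02, h03, h04, h12, h13, h14, h23, h24, h34⟩ := D.turning_all
  rw [D.e_congr (l := j % 10) (by omega)]
  generalize j % 10 = l at h
  interval_cases l <;> simp only [generic, wedge_sub_right, wedge_self, D.wedge_e_anti] <;> linarith

lemma wedge_generic_neg {j : ℕ} (h : 5 ≤ j % 10) : wedge (D.e j) D.generic < 0 := by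
  have := D.wedge_generic_pos (j := j % 10 - 5) (by omega)
  rw [D.e_congr (l := j % 10 - 5 + 5) (by omega), e_antipodal, wedge_neg_left]
  linarith

/-- The points that are moved into the interior by a small step in the generic direction. -/
def entering : Set Plane :=
  {p | ∀ j, 0 < D.gap j p ∨ D.gap j p = 0 ∧ 0 < wedge (D.e j) D.generic}

lemma entering_subset_region : D.entering ⊆ D.region := fun _ h j =>
  (h j).elim (fun h => h.le) fun h => h.1.ge

lemma eventually_entering (p : Plane) : ∀ᶠ t : ℝ in 𝓝[>] 0,
    (p + t • D.generic ∈ D.region → p ∈ D.entering) ∧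
      (p ∈ D.entering → p + t • D.generic ∈ D.core) := by
  have hgap : ∀ j (t : ℝ), D.gap j (p + t • D.generic) =
      D.gap j p + t * wedge (D.e j) D.generic := fun j t => by
    simp only [gap, wedge_sub_right, wedge_add_right, wedge_smul_right]; ring
  have key : ∀ j ∈ Finset.range 10, ∀ᶠ t : ℝ in 𝓝[>] 0,
      (0 ≤ D.gap j (p + t • D.generic) →
        0 < D.gap j p ∨ D.gap j p = 0 ∧ 0 < wedge (D.e j) D.generic) ∧
      ((0 < D.gap j p ∨ D.gap j p = 0 ∧ 0 < wedge (D.e j) D.generic) →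
        0 < D.gap j (p + t • D.generic)) := by
    intro j hj
    have hlim : Tendsto (fun t : ℝ => D.gap j (p + t • D.generic)) (𝓝[>] 0) (𝓝 (D.gap j p)) := by
      simp only [hgap]
      have : Tendsto (fun t : ℝ => D.gap j p + t * wedge (D.e j) D.generic) (𝓝 0)
          (𝓝 (D.gap j p + 0 * wedge (D.e j) D.generic)) := by
        apply Continuous.tendsto; fun_prop
      rw [zero_mul, add_zero] at this
      exact this.mono_left nhdsWithin_le_nhds
    rcases lt_trichotomy (D.gap j p) 0 with h | h | h
    · filter_upwards [hlim.eventually_lt_const h] with t ht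
      exact ⟨fun h' => absurd ht h'.not_gt, fun h' => by rcases h' with h' | h' <;> linarith⟩
    · filter_upwards [self_mem_nhdsWithin] with t ht
      have ht : 0 < t := ht
      rw [hgap, h, zero_add]
      have hj' : j % 10 = j := Nat.mod_eq_of_lt (Finset.mem_range.1 hj)
      rcases lt_or_ge j 5 with h5 | h5
      · have := D.wedge_generic_pos (j := j) (by omega)
        exact ⟨fun _ => .inr ⟨rfl, this⟩, fun _ => mul_pos ht this⟩
      · have := D.wedge_generic_neg (j := j) (by omega)
        have h' := mul_neg_of_pos_of_neg ht this
        exact ⟨fun h => absurd h' h.not_gt,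
          fun h => by rcases h with h | h <;> [exact absurd h (lt_irrefl _); linarith [h.2]]⟩
    · filter_upwards [hlim.eventually_const_lt h] with t ht
      exact ⟨fun _ => .inl h, fun _ => ht⟩
  filter_upwards [(eventually_all_finset (Finset.range 10)).2 key] with t ht
  have hmod : ∀ j, j % 10 ∈ Finset.range 10 :=
    fun j => Finset.mem_range.2 (Nat.mod_lt _ (by norm_num))
  refine ⟨fun h j => ?_, fun h j => ?_⟩
  · have := (ht _ (hmod j)).1 (h _)
    rwa [D.gap_mod, D.e_congr (l := j) (by omega)] at this
  · have := (ht _ (hmod j)).2 (h _)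
    rwa [D.gap_mod] at this

open scoped Classical in
/-- The points that enter the decagon are the inner points, the inner points of the sides
`0, …, 4`, and the vertices between these sides. -/
lemma ite_entering {p : Plane} (hp : p ∈ D.region) : (if p ∈ D.entering then 1 else 0 : ℕ) =
    (if p ∈ D.core then 1 else 0) + ∑ j ∈ Finset.range 5, (if p ∈ D.side j then 1 else 0) +
      ∑ j ∈ Finset.range 4, (if p = D.v (j + 1) then 1 else 0) := by
  have hv : ∀ j, D.gap (j + 9) (D.v j) = 0 := fun j => by
    rw [← D.v_congr (j := j + 9 + 1) (l := j) (by omega), gap_v_succ]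
  have hcv : ∀ j, D.v j ∉ D.core := fun j h => (h j).ne' (D.gap_v_self j)
  have hcs : ∀ j, p ∈ D.side j → p ∉ D.core := fun j h h' => (h' j).ne' h.1
  have hsv : ∀ j k, D.v k ∉ D.side j := fun j k h => by
    by_cases hk : k % 10 = j % 10
    · exact (h.2 (k + 9) (by omega)).ne' (hv k)
    · exact (h.2 k hk).ne' (D.gap_v_self k)
  rcases D.mem_core_or_side_or_vertex hp with h | ⟨k, hk, h⟩ | ⟨k, hk, rfl⟩
  · have h1 : ∀ j, p ∉ D.side j := fun j h' => hcs j h' h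
    have h2 : ∀ j, p ≠ D.v j := fun j h' => hcv j (h' ▸ h)
    have h3 : p ∈ D.entering := fun j => .inl (h j)
    simp [h, h1, h2, h3]
  · have h1 : ∀ j ∈ Finset.range 5, (if p ∈ D.side j then 1 else 0 : ℕ) =
        if j = k then 1 else 0 := by
      intro j hj
      rw [Finset.mem_range] at hj
      congr 1
      refine propext ⟨fun h' => ?_, fun h' => h' ▸ h⟩
      by_contra hne
      exact (h.2 j (by omega)).ne' h'.1
    have h2 : ∀ j, p ≠ D.v j := fun j h' => hsv k j (h' ▸ h)
    have h3 : p ∈ D.entering ↔ k < 5 := by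
      constructor
      · intro h'
        by_contra hk5
        rcases h' k with h' | h'
        · exact h'.ne' h.1
        · linarith [D.wedge_generic_neg (j := k) (by omega), h'.2]
      · intro h5 j
        by_cases hj : j % 10 = k % 10
        · exact .inr ⟨by rw [D.gap_congr hj, h.1], D.wedge_generic_pos (by omega)⟩
        · exact .inl (h.2 j hj)
    rw [Finset.sum_congr rfl h1]
    simp [h2, h3, hcs k h]
  · have h1 : ∀ j ∈ Finset.range 4, (if D.v k = D.v (j + 1) then 1 else 0 : ℕ) =
        if j + 1 = k then 1 else 0 := by
      intro j hj
      rw [Finset.mem_range] at hj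
      congr 1
      refine propext ⟨fun h' => ?_, fun h' => h' ▸ rfl⟩
      by_contra hne
      exact D.v_ne (by omega) h'
    have h3 : D.v k ∈ D.entering ↔ k - 1 < 4 ∧ k ≠ 0 := by
      constructor
      · intro h'
        have ha := h' k
        have hb := h' (k + 9)
        rw [D.gap_v_self] at ha
        rw [hv] at hb
        simp only [lt_irrefl, false_or, true_and] at ha hb
        by_contra hcon
        rcases (by omega : 5 ≤ k ∨ k = 0) with h | rfl
        · linarith [D.wedge_generic_neg (j := k) (by omega)]
        · linarith [D.wedge_generic_neg (j := 0 + 9) (by omega)]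
      · intro h j
        by_cases hj : k % 10 = j % 10
        · exact .inr ⟨by rw [D.v_congr hj, gap_v_self], D.wedge_generic_pos (by omega)⟩
        by_cases hj' : k % 10 = (j + 1) % 10
        · exact .inr ⟨by rw [D.v_congr hj', gap_v_succ], D.wedge_generic_pos (by omega)⟩
        exact .inl (D.gap_v_pos_of_mod hj hj')
    rw [Finset.sum_congr rfl h1]
    simp only [hcv, hsv, h3, if_false, Finset.sum_const_zero, zero_add]
    interval_cases k <;> simp

/-- `X` is a five-fold tiling with translates of the decagon; the interior has been replaced by
the open decagon. -/
def IsTiling {ι : Type*} (X : ι → Plane) : Prop := ∀ p : Plane,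
  5 ≤ {i | p - X i ∈ D.region}.encard ∧ {i | p - X i ∈ D.core}.encard ≤ 5

variable {D} {ι : Type*} {X : ι → Plane}

lemma isTiling_of_isFoldTiling (h : IsFoldTiling 5 D.region X) : D.IsTiling X := fun p =>
  ⟨(h p).1, le_trans (Set.encard_le_encard fun _ hi =>
    interior_maximal D.core_subset_region D.isOpen_core hi) (h p).2⟩

namespace IsTiling

variable (hX : D.IsTiling X)
include hX

lemma shift (a : ℕ) : (D.shift a).IsTiling X := by
  unfold IsTiling
  rw [region_shift, core_shift]
  exact hX

/-- A five-fold tiling is locally finite. -/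
lemma finite_of_isBounded {B : Set Plane} (hB : Bornology.IsBounded B) :
    {i | X i ∈ B}.Finite := by
  have hK : IsCompact (closure B) := hB.isCompact_closure
  refine Set.Finite.subset ?_ (fun i (hi : X i ∈ B) => (subset_closure hi : X i ∈ closure B))
  refine hK.induction_on (p := fun s => {i | X i ∈ s}.Finite) (by simp)
    (fun s t hst ht => ht.subset fun i hi => hst hi)
    (fun s t hs ht => (hs.union ht).subset fun i hi => hi) fun q _ => ?_
  refine ⟨{x | q - x ∈ D.core}, mem_nhdsWithin_of_mem_nhds ?_, ?_⟩
  · refine (D.isOpen_core.preimage (by fun_prop)).mem_nhds ?_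
    simpa using D.zero_mem_core
  · exact Set.finite_of_encard_le_coe (k := 5) (hX q).2

lemma finite_of_subset_region {A : Set Plane} (hA : A ⊆ D.region) (y : Plane) :
    {i | y - X i ∈ A}.Finite := by
  refine (hX.finite_of_isBounded (B := (fun p => y - p) '' D.region) ?_).subset ?_
  · obtain ⟨R, hR⟩ := isBounded_iff_forall_norm_le.1 D.isBounded_region
    refine isBounded_iff_forall_norm_le.2 ⟨‖y‖ + R, ?_⟩
    rintro _ ⟨p, hp, rfl⟩
    exact (norm_sub_le _ _).trans (by gcongr; exact hR p hp)
  · intro i hi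
    exact ⟨y - X i, hA hi, by simp⟩

lemma finite_mult (x : Plane) : {i | X i = x}.Finite :=
  hX.finite_of_isBounded (B := {x}) Bornology.isBounded_singleton

lemma count_entering (y : Plane) : count X D.entering y = 5 := by
  obtain ⟨R, hR⟩ := isBounded_iff_forall_norm_le.1 D.isBounded_region
  have hfin : {i | ‖y - X i‖ ≤ R + ‖D.generic‖}.Finite := by
    refine (hX.finite_of_isBounded (B := Metric.closedBall y (R + ‖D.generic‖))
      Metric.isBounded_closedBall).subset fun i hi => ?_
    rw [Set.mem_ofPred_eq, mem_closedBall_iff_norm']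
    exact hi
  have hev : ∀ᶠ t : ℝ in 𝓝[>] 0, ∀ i ∈ hfin.toFinset,
      (y - X i + t • D.generic ∈ D.region → y - X i ∈ D.entering) ∧
      (y - X i ∈ D.entering → y - X i + t • D.generic ∈ D.core) :=
    (eventually_all_finset _).2 fun i _ => D.eventually_entering _
  obtain ⟨t, ht, ht0, ht1⟩ := (hev.and (Ioo_mem_nhdsGT (zero_lt_one (α := ℝ)))).exists
  have hshift : ∀ i, y + t • D.generic - X i = y - X i + t • D.generic := fun i => by abel
  have hle : ∀ i, y + t • D.generic - X i ∈ D.region → y - X i ∈ D.entering := by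
    intro i hi
    rw [hshift] at hi
    refine (ht i ?_).1 hi
    rw [Set.Finite.mem_toFinset, Set.mem_ofPred_eq]
    have h1 := hR _ hi
    have h2 : ‖t • D.generic‖ ≤ ‖D.generic‖ := by
      rw [norm_smul, Real.norm_of_nonneg ht0.le]
      exact mul_le_of_le_one_left (norm_nonneg _) ht1.le
    calc ‖y - X i‖ = ‖(y - X i + t • D.generic) - t • D.generic‖ := by rw [add_sub_cancel_right]
      _ ≤ _ := (norm_sub_le _ _).trans (by linarith)
  have hge : ∀ i, y - X i ∈ D.entering → y + t • D.generic - X i ∈ D.core := by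
    intro i hi
    rw [hshift]
    refine (ht i ?_).2 hi
    rw [Set.Finite.mem_toFinset, Set.mem_ofPred_eq]
    linarith [hR _ (D.entering_subset_region hi), norm_nonneg D.generic]
  have h5 : {i | y - X i ∈ D.entering}.encard = 5 := by
    apply le_antisymm
    · exact (Set.encard_le_encard fun i hi => hge i hi).trans (hX _).2
    · exact (hX (y + t • D.generic)).1.trans (Set.encard_le_encard fun i hi => hle i hi)
  rw [count, Set.ncard, h5]
  rfl

/-- Five translates cover the points that are reached from `y` by a small step in a generic
direction; they are counted according to the position of `y` in them. -/
lemma count_eq (y : Plane) : count X D.core y + ∑ j ∈ Finset.range 5, count X (D.side j) y +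
    ∑ j ∈ Finset.range 4, mult X (y - D.v (j + 1)) = 5 := by
  classical
  refine Eq.trans ?_ (hX.count_entering y)
  have hfin := hX.finite_of_subset_region (subset_refl D.region) y
  have hcount : ∀ A ⊆ D.region, count X A y =
      ∑ i ∈ hfin.toFinset, if y - X i ∈ A then 1 else 0 := by
    intro A hA
    rw [← Finset.card_filter, count, ← Set.ncard_coe_finset]
    congr 1
    ext i
    simpa using fun h => hA h
  have hside : ∀ j, D.side j ⊆ D.region := fun j p hp l => by
    by_cases h : l % 10 = j % 10
    · rw [D.gap_congr h, hp.1]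
    · exact (hp.2 l h).le
  have hmult : ∀ j, mult X (y - D.v j) =
      ∑ i ∈ hfin.toFinset, if y - X i = D.v j then 1 else 0 := by
    intro j
    rw [show mult X (y - D.v j) = count X {D.v j} y by
      simp only [mult, count, Set.mem_singleton_iff]
      congr 1; ext i
      exact ⟨fun h => by rw [Set.mem_ofPred_eq] at h ⊢; rw [h]; abel,
        fun h => by rw [Set.mem_ofPred_eq] at h ⊢; rw [← h]; abel⟩]
    rw [hcount _ (by simpa using D.v_mem_region j)]
    simp
  rw [hcount _ D.core_subset_region, hcount _ D.entering_subset_region,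
    Finset.sum_congr rfl fun j _ => hcount _ (hside j), Finset.sum_congr rfl fun j _ => hmult _,
    Finset.sum_comm, Finset.sum_comm (s := Finset.range 4), ← Finset.sum_add_distrib,
    ← Finset.sum_add_distrib]
  refine Finset.sum_congr rfl fun i hi => ?_
  exact (D.ite_entering (by simpa using hi)).symm

end IsTiling

end CentredDecagon

/-! ### Vertex counts -/

namespace CentredDecagon

variable (D : CentredDecagon) {ι : Type*} (X : ι → Plane)

/-- The number of translates with vertex `v 0` or `-v 0` at `y`. In a tiling it is the number of
translates with vertex `v k` or `-v k` at `y`, for every `k`. -/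
noncomputable def vertexCount (y : Plane) : ℕ := mult X (y - D.v 0) + mult X (y + D.v 0)

/-- The number of translates with `y` in the relative interior of a side. -/
noncomputable def sideCount (y : Plane) : ℕ := ∑ j ∈ Finset.range 10, count X (D.side j) y

namespace IsTiling

variable {D X} (hX : D.IsTiling X)
include hX

lemma count_shift (k : ℕ) (y : Plane) : count X D.core y +
    (∑ j ∈ Finset.range 5, count X (D.side (k + j)) y) +
    (∑ j ∈ Finset.range 4, mult X (y - D.v (k + (j + 1)))) = 5 := by
  simpa [core_shift, side_shift] using (hX.shift k).count_eq y

/-- Along side `0` equally many translates lie on either side. -/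
lemma count_side_balance (y : Plane) :
    count X (D.side 5) y + mult X (y + D.v 1) = count X (D.side 0) y + mult X (y - D.v 0) := by
  have h5 := hX.count_shift 5 y
  have h6 := hX.count_shift 6 y
  simp only [Finset.sum_range_succ, Finset.sum_range_zero, zero_add, Nat.reduceAdd] at h5 h6
  rw [show D.v 10 = D.v 0 from D.v_add_ten 0, D.side_congr (j := 10) (l := 0) (by norm_num)] at h6
  rw [show D.v 6 = -D.v 1 from D.antipodal 1, sub_neg_eq_add] at h5
  omega

lemma mult_add_mult (k : ℕ) (y : Plane) :
    mult X (y - D.v k) + mult X (y + D.v k) = D.vertexCount X y := by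
  have key : ∀ D : CentredDecagon, D.IsTiling X →
      mult X (y - D.v 1) + mult X (y + D.v 1) = mult X (y - D.v 0) + mult X (y + D.v 0) := by
    intro D hX
    have h0 := hX.count_side_balance y
    have h5 := (hX.shift 5).count_side_balance y
    simp only [side_shift, shift_v, Nat.reduceAdd] at h5
    rw [D.side_congr (j := 10) (l := 0) (by norm_num), show D.v 6 = -D.v 1 from D.antipodal 1,
      D.v_five, sub_neg_eq_add, ← sub_eq_add_neg] at h5
    omega
  induction k with
  | zero => rfl
  | succ k ih =>
    have := key _ (hX.shift k)
    simp only [shift_v, add_zero] at this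
    rw [← ih, this]

/-- The translates that contain `y`, each weighted with the angle that it takes up at `y`, in units
of a half-turn: the angles at the five vertices `v 0, …, v 4` add up to four half-turns. -/
lemma two_mul_count (y : Plane) :
    2 * count X D.core y + D.sideCount X y + 4 * D.vertexCount X y = 10 := by
  have h0 := hX.count_shift 0 y
  have h5 := hX.count_shift 5 y
  simp only [Finset.sum_range_succ, Finset.sum_range_zero, zero_add, Nat.reduceAdd] at h0 h5
  rw [show D.v 6 = -D.v 1 from D.antipodal 1, show D.v 7 = -D.v 2 from D.antipodal 2,
    show D.v 8 = -D.v 3 from D.antipodal 3, show D.v 9 = -D.v 4 from D.antipodal 4] at h5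
  simp only [sub_neg_eq_add] at h5
  have h1 := hX.mult_add_mult 1 y
  have h2 := hX.mult_add_mult 2 y
  have h3 := hX.mult_add_mult 3 y
  have h4 := hX.mult_add_mult 4 y
  simp only [sideCount, Finset.sum_range_succ, Finset.sum_range_zero, zero_add]
  omega

/-- Inner points contribute to the number of translates that contain `y` in their interior. -/
lemma sum_mult_le (y : Plane) (S : Finset Plane) (hS : ∀ p ∈ S, p ∈ D.core) :
    ∑ p ∈ S, mult X (y - p) ≤ count X D.core y := by
  classical
  have hfin := hX.finite_of_subset_region D.core_subset_region y
  have hfp : ∀ p, {i | X i = y - p}.Finite := fun p => hX.finite_mult _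
  have h1 : ∀ p ∈ S, mult X (y - p) = (hfp p).toFinset.card := fun p _ =>
    Set.ncard_eq_toFinset_card _ _
  rw [Finset.sum_congr rfl h1, ← Finset.card_biUnion, count, Set.ncard_eq_toFinset_card _ hfin]
  · apply Finset.card_le_card
    intro i hi
    simp only [Finset.mem_biUnion, Set.Finite.mem_toFinset, Set.mem_ofPred_eq] at hi ⊢
    obtain ⟨p, hp, h⟩ := hi
    rw [h, sub_sub_cancel]
    exact hS p hp
  · intro p _ q _ hpq
    refine Finset.disjoint_left.2 fun i hi hi' => hpq ?_
    simp only [Set.Finite.mem_toFinset, Set.mem_ofPred_eq] at hi hi'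
    exact sub_right_injective (hi.symm.trans hi')

lemma list_sum_mult_le (y : Plane) (l : List Plane) (hl : l.Nodup) (h : ∀ p ∈ l, p ∈ D.core) :
    (l.map fun p => mult X (y - p)).sum ≤ count X D.core y := by
  classical
  have := hX.sum_mult_le y l.toFinset (by simpa using h)
  rwa [List.sum_toFinset _ hl] at this

end IsTiling

end CentredDecagon

/-! ### Neighbours along the sides -/

lemma not_strictly_decreasing {f : ℕ → ℕ} (h : ∀ n, f (n + 1) + 1 ≤ f n) : False := by
  have : ∀ n, f n + n ≤ f 0 := fun n => by
    induction n with
    | zero => simp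
    | succ n ih => have := h n; omega
  have := this (f 0 + 1)
  omega

lemma not_decreasing_by_two {f : ℕ → ℕ} (h : ∀ n, f (n + 2) + 1 ≤ f n) : False :=
  not_strictly_decreasing (f := fun n => f (2 * n)) fun n => h (2 * n)

namespace CentredDecagon

variable (D : CentredDecagon)

lemma s_zero : D.s 0 = -(D.e 1 + D.e 2 + D.e 3 + D.e 4) := by
  simp only [s, zero_add, v_one, v_zero]; module

lemma s_one : D.s 1 = D.e 0 - D.e 2 - D.e 3 - D.e 4 := by
  simp only [s, Nat.reduceAdd, v_one, v_two, v_zero]; module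

lemma s_two : D.s 2 = D.e 0 + D.e 1 - D.e 3 - D.e 4 := by
  simp only [s, Nat.reduceAdd, v_three, v_two, v_zero]; module

lemma s_three : D.s 3 = D.e 0 + D.e 1 + D.e 2 - D.e 4 := by
  simp only [s, Nat.reduceAdd, v_three, v_four, v_zero]; module

lemma s_four : D.s 4 = D.e 0 + D.e 1 + D.e 2 + D.e 3 := by
  simp only [s, Nat.reduceAdd, v_five, v_four, v_zero]; module

/-- If `s 2 = 2 e 0`, then of the relations `s (k + 2) = 2 e k` and `s (k + 3) = 2 e k`,
`k = 1, 2, 3, 4`, only the relation `s 5 = 2 e 2` is possible. The proof multiplies the relations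
with the sides, which gives linear relations between the positive numbers `e i ∧ e j`, `i < j`. -/
lemma relation_of_s_two (h : D.s 2 = (2 : ℝ) • D.e 0) {k : ℕ} (h1 : 1 ≤ k) (h4 : k ≤ 4)
    (hk : D.s (k + 2) = (2 : ℝ) • D.e k ∨ D.s (k + 3) = (2 : ℝ) • D.e k) :
    k = 2 ∧ D.s 5 = (2 : ℝ) • D.e 2 := by
  obtain ⟨h01, h02, h03, h04, h12, h13, h14, h23, h24, h34⟩ := D.turning_all
  by_cases hgood : k = 2 ∧ D.s 5 = (2 : ℝ) • D.e 2
  · exact hgood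
  exfalso
  have hs5 := D.s_antipodal 0
  have hs6 := D.s_antipodal 1
  have hs7 := D.s_antipodal 2
  norm_num only at hs5 hs6 hs7
  have w : ∀ i, wedge (D.e i) (D.s 2) = wedge (D.e i) ((2 : ℝ) • D.e 0) := fun i => by rw [h]
  have w0 := w 0
  have w1 := w 1
  have w2 := w 2
  have w3 := w 3
  have w4 := w 4
  rcases hk with hk | hk <;> interval_cases k <;> norm_num only at hk hgood <;>
    first
    | exact hgood ⟨trivial, hk⟩
    | have u := fun i => congrArg (wedge (D.e i)) hk
      have u0 := u 0
      have u1 := u 1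
      have u2 := u 2
      have u3 := u 3
      have u4 := u 4
      simp only [hs5, hs6, hs7, s_zero, s_one, s_two, s_three, s_four, wedge_add_right,
        wedge_sub_right, wedge_neg_right, wedge_smul_right, wedge_self, D.wedge_e_anti]
        at w0 w1 w2 w3 w4 u0 u1 u2 u3 u4
      linarith

/-- If `s 3 = 2 e 0`, then of the relations `s (k + 2) = 2 e k` and `s (k + 3) = 2 e k`,
`k = 1, 2, 3, 4`, only the relation `s 5 = 2 e 3` is possible. -/
lemma relation_of_s_three (h : D.s 3 = (2 : ℝ) • D.e 0) {k : ℕ} (h1 : 1 ≤ k) (h4 : k ≤ 4)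
    (hk : D.s (k + 2) = (2 : ℝ) • D.e k ∨ D.s (k + 3) = (2 : ℝ) • D.e k) :
    k = 3 ∧ D.s 5 = (2 : ℝ) • D.e 3 := by
  obtain ⟨h01, h02, h03, h04, h12, h13, h14, h23, h24, h34⟩ := D.turning_all
  by_cases hgood : k = 3 ∧ D.s 5 = (2 : ℝ) • D.e 3
  · exact hgood
  exfalso
  have hs5 := D.s_antipodal 0
  have hs6 := D.s_antipodal 1
  have hs7 := D.s_antipodal 2
  norm_num only at hs5 hs6 hs7
  have w : ∀ i, wedge (D.e i) (D.s 3) = wedge (D.e i) ((2 : ℝ) • D.e 0) := fun i => by rw [h]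
  have w0 := w 0
  have w1 := w 1
  have w2 := w 2
  have w3 := w 3
  have w4 := w 4
  rcases hk with hk | hk <;> interval_cases k <;> norm_num only at hk hgood <;>
    first
    | exact hgood ⟨trivial, hk⟩
    | have u := fun i => congrArg (wedge (D.e i)) hk
      have u0 := u 0
      have u1 := u 1
      have u2 := u 2
      have u3 := u 3
      have u4 := u 4
      simp only [hs5, hs6, hs7, s_zero, s_one, s_two, s_three, s_four, wedge_add_right,
        wedge_sub_right, wedge_neg_right, wedge_smul_right, wedge_self, D.wedge_e_anti]
        at w0 w1 w2 w3 w4 u0 u1 u2 u3 u4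
      linarith

namespace IsTiling

variable {D} {ι : Type*} {X : ι → Plane} (hX : D.IsTiling X)
include hX

/-- The vertex count cannot be at least two at all places `y + n e 0`. Since `v k - e 0` is an inner
point for `k = 2, 3, 4`, a translate with vertex `v k` at one place has the preceding place in its
interior, and one with vertex `-v k` the following place. So the vertices alone would give two
inner points on average, where `two_mul_count` leaves room for only one. -/
lemma exists_vertexCount_le_one (y : Plane) :
    ∃ n : ℕ, D.vertexCount X (y + (n : ℝ) • D.e 0) ≤ 1 := by
  by_contra! hcon
  obtain ⟨k, h2, h4, hk⟩ : ∃ k, 2 ≤ k ∧ k ≤ 4 ∧ D.v k ≠ D.e 0 := by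
    by_cases h : D.v 2 = D.e 0
    · exact ⟨3, by norm_num, by norm_num, fun h' => D.v_ne (by norm_num) (h.trans h'.symm)⟩
    · exact ⟨2, le_rfl, by norm_num, h⟩
  set Y : ℕ → Plane := fun n => y + (n : ℝ) • D.e 0 with hY
  have hc := D.v_sub_e_mem_core h2 h4
  apply not_decreasing_by_two (f := fun n => mult X (Y n - D.v k))
  intro n
  have hsum := hX.list_sum_mult_le (Y (n + 1)) [D.v k - D.e 0, -(D.v k - D.e 0)]
    (by
      simp only [List.nodup_cons, List.mem_singleton, List.not_mem_nil, not_false_eq_true,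
        List.nodup_nil, and_true]
      exact fun h => hk (sub_eq_zero.1 (eq_zero_of_eq_neg h)))
    (by simp only [List.mem_cons, List.not_mem_nil, or_false, forall_eq_or_imp, forall_eq]
        exact ⟨hc, D.neg_mem_core hc⟩)
  simp only [List.map_cons, List.map_nil, List.sum_cons, List.sum_nil, add_zero] at hsum
  rw [show Y (n + 1) - (D.v k - D.e 0) = Y (n + 2) - D.v k by simp only [hY]; push_cast; module,
    show Y (n + 1) - -(D.v k - D.e 0) = Y n + D.v k by simp only [hY]; push_cast; module] at hsum
  have h1 := hX.two_mul_count (Y (n + 1))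
  have h3 := hX.mult_add_mult k (Y n)
  have h5 := hcon n
  have h6 := hcon (n + 1)
  change 2 ≤ D.vertexCount X (Y n) at h5
  change 2 ≤ D.vertexCount X (Y (n + 1)) at h6
  show mult X (Y (n + 2) - D.v k) + 1 ≤ mult X (Y n - D.v k)
  omega

/-- The difference of the multiplicities of `x` and `x + s 0` has the period `e 0`. -/
lemma mult_balance (x : Plane) : mult X x + mult X (x + D.e 0 + D.s 0) =
    mult X (x + D.s 0) + mult X (x + D.e 0) := by
  have h := hX.mult_add_mult 1 (x + D.v 1)
  have h' := hX.mult_add_mult 0 (x + D.v 1)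
  rw [← h', show x + D.v 1 - D.v 1 = x by abel,
    show x + D.v 1 + D.v 1 = x + D.e 0 + D.s 0 by simp only [e, s, zero_add]; abel,
    show x + D.v 1 - D.v 0 = x + D.e 0 by simp only [e, zero_add]; abel,
    show x + D.v 1 + D.v 0 = x + D.s 0 by simp only [s, zero_add]; abel] at h
  omega

lemma mult_lt_row {x : Plane} (hx : mult X (x + D.s 0) < mult X x) (n : ℕ) :
    mult X (x + (n : ℝ) • D.e 0 + D.s 0) < mult X (x + (n : ℝ) • D.e 0) := by
  induction n with
  | zero => simpa using hx
  | succ n ih =>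
    have h := hX.mult_balance (x + (n : ℝ) • D.e 0)
    rw [show x + (n : ℝ) • D.e 0 + D.e 0 = x + ((n + 1 : ℕ) : ℝ) • D.e 0 by
      push_cast; module] at h
    omega

/-- Opposite vertices of a translate never differ by a multiple of `e 0` if there is an unbalanced
row in the direction `e 0`: they would produce a vertex count of two along the whole row. -/
lemma two_smul_v_ne {x : Plane} (hx : mult X (x + D.s 0) < mult X x) (k j : ℕ) :
    (2 : ℝ) • D.v k ≠ (j : ℝ) • D.e 0 := by
  intro h
  obtain ⟨n, hn⟩ := hX.exists_vertexCount_le_one (x + D.v k)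
  rw [← hX.mult_add_mult k] at hn
  have h1 := hX.mult_lt_row hx n
  have h2 := hX.mult_lt_row hx (n + j)
  rw [show x + D.v k + (n : ℝ) • D.e 0 - D.v k = x + (n : ℝ) • D.e 0 by module,
    show x + D.v k + (n : ℝ) • D.e 0 + D.v k = x + ((n + j : ℕ) : ℝ) • D.e 0 by
      push_cast; linear_combination (norm := module) h] at hn
  omega

/-- At a point `y = x + v 0 + n e 0` of an unbalanced row there is a vertex, and the imbalance puts
`y` into the relative interior of a side of some translate. So at most two translates contain `y`
in their interior. -/
lemma count_core_row_le {x : Plane} (hx : mult X (x + D.s 0) < mult X x) (n : ℕ) :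
    count X D.core (x + D.v 0 + (n : ℝ) • D.e 0) ≤ 2 ∧
      1 ≤ D.vertexCount X (x + D.v 0 + (n : ℝ) • D.e 0) := by
  set y := x + D.v 0 + (n : ℝ) • D.e 0 with hy
  have hlt := hX.mult_lt_row hx n
  have hb := hX.count_side_balance y
  rw [show y + D.v 1 = x + (n : ℝ) • D.e 0 + D.s 0 by simp only [hy, s, zero_add]; abel,
    show y - D.v 0 = x + (n : ℝ) • D.e 0 by simp only [hy]; abel] at hb
  have hs : count X (D.side 5) y ≤ D.sideCount X y :=
    Finset.single_le_sum (f := fun j => count X (D.side j) y) (fun _ _ => Nat.zero_le _)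
      (Finset.mem_range.2 (by norm_num : 5 < 10))
  have hv : mult X (x + (n : ℝ) • D.e 0) ≤ D.vertexCount X y := by
    rw [vertexCount, show y - D.v 0 = x + (n : ℝ) • D.e 0 by simp only [hy]; abel]
    exact Nat.le_add_right _ _
  have := hX.two_mul_count y
  omega

/-- An imbalance in the direction `s 0` forces a relation between the sides. Otherwise the points
`±(v k - e 0)`, `k = 2, 3, 4`, are six different inner points of the decagon, or, in the case
`v 2 + v 4 = 2 e 0`, they form six different inner points together with `±(v 3 - 2 e 0)`. On average
over the row, three of the six translates that have such a point at the given place belong to the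
tiling, which contradicts `count_core_row_le`. -/
lemma relation_of_lt {x : Plane} (hx : mult X (x + D.s 0) < mult X x) :
    D.s 2 = (2 : ℝ) • D.e 0 ∨ D.s 3 = (2 : ℝ) • D.e 0 := by
  by_contra! hcon
  obtain ⟨h23, h34⟩ := hcon
  change D.v 2 + D.v 3 ≠ _ at h23
  change D.v 3 + D.v 4 ≠ _ at h34
  set Y : ℕ → Plane := fun n => x + D.v 0 + (n : ℝ) • D.e 0 with hY
  have hφ : ∀ n, count X D.core (Y n) ≤ 2 ∧ 1 ≤ D.vertexCount X (Y n) :=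
    fun n => hX.count_core_row_le hx n
  have hsum : ∀ k n, mult X (Y n - D.v k) + mult X (Y n + D.v k) = D.vertexCount X (Y n) :=
    fun k n => hX.mult_add_mult k (Y n)
  have hself : ∀ k, D.v k ≠ D.e 0 := fun k h => hX.two_smul_v_ne hx k 2 (by rw [h]; norm_num)
  have hneg : ∀ k, D.v k - D.e 0 ≠ -(D.v k - D.e 0) := fun k h =>
    hself k (sub_eq_zero.1 (eq_zero_of_eq_neg h))
  have hv : ∀ {j k : ℕ}, j % 10 ≠ k % 10 → D.v j - D.e 0 ≠ D.v k - D.e 0 := fun h h' =>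
    D.v_ne h (sub_left_injective h')
  have c2 := D.v_sub_e_mem_core (k := 2) (by norm_num) (by norm_num)
  have c3 := D.v_sub_e_mem_core (k := 3) (by norm_num) (by norm_num)
  have c4 := D.v_sub_e_mem_core (k := 4) (by norm_num) (by norm_num)
  have h23n : D.v 2 - D.e 0 ≠ -(D.v 3 - D.e 0) := fun h => h23 (by
    linear_combination (norm := module) h)
  have h34n : D.v 3 - D.e 0 ≠ -(D.v 4 - D.e 0) := fun h => h34 (by
    linear_combination (norm := module) h)
  have hadd : ∀ k n, Y (n + 1) - (D.v k - D.e 0) = Y (n + 2) - D.v k := fun k n => by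
    simp only [hY]; push_cast; module
  have hsub : ∀ k n, Y (n + 1) - -(D.v k - D.e 0) = Y n + D.v k := fun k n => by
    simp only [hY]; push_cast; module
  have hsix : ∀ {a b c : Plane}, a ≠ b → a ≠ c → a ≠ -a → a ≠ -b → a ≠ -c → b ≠ c →
      b ≠ -b → b ≠ -c → c ≠ -c → [a, b, c, -a, -b, -c].Nodup := by
    intro a b c h1 h2 h3 h4 h5 h6 h7 h8 h9
    have h4' : b ≠ -a := fun h => h4 (by rw [h, neg_neg])
    have h5' : c ≠ -a := fun h => h5 (by rw [h, neg_neg])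
    have h8' : c ≠ -b := fun h => h8 (by rw [h, neg_neg])
    simp only [List.nodup_cons, List.mem_cons, List.not_mem_nil, or_false, not_or, neg_inj,
      not_false_eq_true, List.nodup_nil, and_true]
    exact ⟨⟨h1, h2, h3, h4, h5⟩, ⟨h6, h4', h7, h8⟩, ⟨h5', h8', h9⟩, ⟨h1, h2⟩, h6⟩
  have hcore : ∀ {a b c : Plane}, a ∈ D.core → b ∈ D.core → c ∈ D.core →
      ∀ p ∈ [a, b, c, -a, -b, -c], p ∈ D.core := by
    intro a b c ha hb hc
    simp only [List.mem_cons, List.not_mem_nil, or_false, forall_eq_or_imp, forall_eq]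
    exact ⟨ha, hb, hc, D.neg_mem_core ha, D.neg_mem_core hb, D.neg_mem_core hc⟩
  by_cases h24 : D.v 2 + D.v 4 = (2 : ℝ) • D.e 0
  · -- Here `v 4 - e 0 = -(v 2 - e 0)`, but the decagon is so long in the direction of `e 0` that
    -- also `v 3 - 2 e 0` is an inner point.
    have hd : D.v 3 - (2 : ℝ) • D.e 0 ∈ D.core := by
      rw [show D.v 3 - (2 : ℝ) • D.e 0 = D.e 2 - D.v 4 by
        rw [← h24]; simp only [e, Nat.reduceAdd]; abel]
      exact D.e_sub_v_four_mem_core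
    have hnodup : [D.v 2 - D.e 0, D.v 3 - D.e 0, D.v 3 - (2 : ℝ) • D.e 0, -(D.v 2 - D.e 0),
        -(D.v 3 - D.e 0), -(D.v 3 - (2 : ℝ) • D.e 0)].Nodup := by
      refine hsix (hv (by norm_num)) (fun h => ?_) (hneg 2) h23n (fun h => ?_) (fun h => ?_)
        (hneg 3) (fun h => ?_) (fun h => ?_)
      · refine D.e_ne 0 (j := 2) (by norm_num) (by norm_num) ?_
        show D.v 3 - D.v 2 = D.e 0
        linear_combination (norm := module) -h
      · refine D.e_ne 3 (j := 2) (by norm_num) (by norm_num) ?_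
        rw [D.e_antipodal 0]
        show -D.e 0 = D.v 4 - D.v 3
        linear_combination (norm := module) h - h24
      · refine D.v_ne (j := 1) (k := 0) (by norm_num) ?_
        have : D.e 0 = 0 := by linear_combination (norm := module) h
        exact sub_eq_zero.1 this
      · refine hX.two_smul_v_ne hx 3 3 ?_
        push_cast
        linear_combination (norm := module) h
      · refine hX.two_smul_v_ne hx 3 4 ?_
        push_cast
        linear_combination (norm := module) h
    apply not_strictly_decreasing (f := fun n => mult X (Y (n + 1) - D.v 2) +
      mult X (Y (n + 2) - D.v 2) + mult X (Y n - D.v 3) + 2 * mult X (Y (n + 1) - D.v 3) +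
      2 * mult X (Y (n + 2) - D.v 3) + mult X (Y (n + 3) - D.v 3))
    intro n
    have h := hX.list_sum_mult_le (Y (n + 2)) _ hnodup (hcore c2 c3 hd)
    simp only [List.map_cons, List.map_nil, List.sum_cons, List.sum_nil, add_zero] at h
    rw [hadd 2 (n + 1), hadd 3 (n + 1), hsub 2 (n + 1), hsub 3 (n + 1),
      show Y (n + 2) - (D.v 3 - (2 : ℝ) • D.e 0) = Y (n + 4) - D.v 3 by
        simp only [hY]; push_cast; module,
      show Y (n + 2) - -(D.v 3 - (2 : ℝ) • D.e 0) = Y n + D.v 3 by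
        simp only [hY]; push_cast; module] at h
    simp only [add_assoc, Nat.reduceAdd] at h ⊢
    have := hφ (n + 2)
    have := hφ (n + 1)
    have := hφ n
    have := hsum 2 (n + 1)
    have := hsum 3 (n + 1)
    have := hsum 3 n
    omega
  · have h24n : D.v 2 - D.e 0 ≠ -(D.v 4 - D.e 0) := fun h => h24 (by
      linear_combination (norm := module) h)
    have hnodup := hsix (hv (j := 2) (k := 3) (by norm_num)) (hv (k := 4) (by norm_num)) (hneg 2)
      h23n h24n (hv (by norm_num)) (hneg 3) h34n (hneg 4)
    apply not_decreasing_by_two (f := fun n => mult X (Y n - D.v 2) + mult X (Y n - D.v 3) +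
      mult X (Y n - D.v 4))
    intro n
    have h := hX.list_sum_mult_le (Y (n + 1)) _ hnodup (hcore c2 c3 c4)
    simp only [List.map_cons, List.map_nil, List.sum_cons, List.sum_nil, add_zero, hadd, hsub] at h
    have := hφ (n + 1)
    have := hφ n
    have := hsum 2 n
    have := hsum 3 n
    have := hsum 4 n
    show mult X (Y (n + 2) - D.v 2) + mult X (Y (n + 2) - D.v 3) + mult X (Y (n + 2) - D.v 4) + 1 ≤
      mult X (Y n - D.v 2) + mult X (Y n - D.v 3) + mult X (Y n - D.v 4)
    omega

lemma relation_of_ne {k : ℕ} {x : Plane} (hx : mult X (x + D.s k) ≠ mult X x) :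
    D.s (k + 2) = (2 : ℝ) • D.e k ∨ D.s (k + 3) = (2 : ℝ) • D.e k := by
  rcases hx.lt_or_gt with h | h
  · exact (hX.shift k).relation_of_lt (x := x) h
  · have h' := (hX.shift (k + 5)).relation_of_lt (x := x + D.s k)
      (by simpa [D.s_antipodal k] using h)
    simp only [shift_s, shift_e, add_zero] at h'
    rw [D.e_antipodal, show k + 5 + 2 = k + 2 + 5 by ring, show k + 5 + 3 = k + 3 + 5 by ring,
      D.s_antipodal, D.s_antipodal, smul_neg, neg_inj, neg_inj] at h'
    exact h'

/-- An imbalance does not come alone. At a point with vertex count one, each antipodal pair of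
vertices is represented once; the passage from `v k` to `v (k + 1)` changes the sign of the
representative if and only if side `k` is balanced there, and going from `v 0` to `v 5 = -v 0`
the sign changes an odd number of times. -/
lemma exists_ne_of_lt {x : Plane} (hx : mult X (x + D.s 0) < mult X x) :
    ∃ k, 1 ≤ k ∧ k ≤ 4 ∧ ∃ z, mult X (z + D.s k) ≠ mult X z := by
  by_contra! hcon
  obtain ⟨n, hn⟩ := hX.exists_vertexCount_le_one (x + D.v 0)
  set y := x + D.v 0 + (n : ℝ) • D.e 0 with hy
  have hlt := hX.mult_lt_row hx n
  rw [show x + (n : ℝ) • D.e 0 + D.s 0 = y + D.v 1 by simp only [hy, s, zero_add]; abel,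
    show x + (n : ℝ) • D.e 0 = y - D.v 0 by simp only [hy]; abel] at hlt
  have hstep : ∀ k, 1 ≤ k → k ≤ 4 → mult X (y + D.v (k + 1)) = mult X (y - D.v k) := by
    intro k h1 h4
    rw [← hcon k h1 h4 (y - D.v k)]
    congr 1
    simp only [s]; abel
  have h1 := hstep 1 (by norm_num) (by norm_num)
  have h2 := hstep 2 (by norm_num) (by norm_num)
  have h3 := hstep 3 (by norm_num) (by norm_num)
  have h4 := hstep 4 (by norm_num) (by norm_num)
  simp only [Nat.reduceAdd, v_five, ← sub_eq_add_neg] at h1 h2 h3 h4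
  have k0 := hX.mult_add_mult 0 y
  have k1 := hX.mult_add_mult 1 y
  have k2 := hX.mult_add_mult 2 y
  have k3 := hX.mult_add_mult 3 y
  have k4 := hX.mult_add_mult 4 y
  omega

/-- By `relation_of_s_two`, the first relation makes `s 3` and `s 4` periods, hence also their
difference `e 3 + e 4`. By the second relation `2 v 2` equals `e 0` modulo this period, so that the
vertex count is at least two along the row through `x + v 2`. -/
lemma not_two_relations {x : Plane} (hx : mult X (x + D.s 0) < mult X x)
    (h0 : D.s 2 = (2 : ℝ) • D.e 0) (h2 : D.s 5 = (2 : ℝ) • D.e 2) : False := by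
  have hper : ∀ k, 3 ≤ k → k ≤ 4 → ∀ z, mult X (z + D.s k) = mult X z := by
    intro k h3 h4 z
    by_contra hz
    have := D.relation_of_s_two h0 (by omega) h4 (hX.relation_of_ne hz)
    omega
  have hq : ∀ z, mult X (z + (D.e 3 + D.e 4)) = mult X z := by
    intro z
    rw [← hper 3 le_rfl (by norm_num) (z + (D.e 3 + D.e 4)), ← hper 4 (by norm_num) le_rfl z]
    congr 1
    simp only [s_three, s_four]; abel
  obtain ⟨n, hn⟩ := hX.exists_vertexCount_le_one (x + D.v 2)
  rw [← hX.mult_add_mult 2, ← hq (_ + D.v 2),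
    ← hq (_ + D.v 2 + _)] at hn
  have h1 := hX.mult_lt_row hx n
  have h1' := hX.mult_lt_row hx (n + 1)
  have h5 := D.s_antipodal 0
  norm_num only at h5
  rw [h5, s_zero] at h2
  rw [show x + D.v 2 + (n : ℝ) • D.e 0 - D.v 2 = x + (n : ℝ) • D.e 0 by module,
    show x + D.v 2 + (n : ℝ) • D.e 0 + D.v 2 + (D.e 3 + D.e 4) + (D.e 3 + D.e 4) =
      x + ((n + 1 : ℕ) : ℝ) • D.e 0 by
      simp only [v_two, v_zero]; push_cast
      linear_combination (norm := module) h2] at hn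
  omega

lemma not_mult_lt (x : Plane) : ¬ mult X (x + D.s 0) < mult X x := by
  intro hx
  obtain ⟨k, h1, h4, z, hz⟩ := hX.exists_ne_of_lt hx
  have hk := hX.relation_of_ne hz
  rcases hX.relation_of_lt hx with h0 | h0
  · obtain ⟨-, h2⟩ := D.relation_of_s_two h0 h1 h4 hk
    exact hX.not_two_relations hx h0 h2
  · obtain ⟨rfl, h3⟩ := D.relation_of_s_three h0 h1 h4 hk
    have s8 : D.s 8 = -D.s 3 := D.s_antipodal 3
    have e5 : D.e 5 = -D.e 0 := D.e_antipodal 0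
    have e8 : D.e 8 = -D.e 3 := D.e_antipodal 3
    have s10 : D.s 10 = -D.s 5 := D.s_antipodal 5
    have e10 : D.e 10 = -D.e 5 := D.e_antipodal 5
    have s13 : D.s 13 = -D.s 8 := D.s_antipodal 8
    rcases hz.lt_or_gt with h | h
    · refine (hX.shift 3).not_two_relations (x := z) h h3 ?_
      show D.s 8 = (2 : ℝ) • D.e 5
      rw [s8, e5, h0, smul_neg]
    · refine (hX.shift 8).not_two_relations (x := z + D.s 3) ?_ ?_ ?_
      · simpa [s8] using h
      · show D.s 10 = (2 : ℝ) • D.e 8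
        rw [s10, e8, h3, smul_neg]
      · show D.s 13 = (2 : ℝ) • D.e 10
        rw [s13, s8, e10, e5, neg_neg, neg_neg, h0]

/-- In a five-fold tiling every translate has a neighbour along every side. -/
theorem mult_add_s (k : ℕ) (x : Plane) : mult X (x + D.s k) = mult X x := by
  apply le_antisymm
  · have := (hX.shift (k + 5)).not_mult_lt (x + D.s k)
    simpa [D.s_antipodal k] using this
  · have := (hX.shift k).not_mult_lt x
    simpa using this

end IsTiling

end CentredDecagon

/-! ### The lattice -/

/-- The estimate for the step that moves the point `t ((1 - θ) a + θ b)` of a side `ab`, blown up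
by the factor `t`, by the vector `a + b`; here `A` and `B` are the values of a linear form
at `a` and `b`. -/
lemma descent_estimate {t θ A B H : ℝ} (ht : 1 < t) (h0 : 0 ≤ θ) (h1 : θ ≤ 1) (hA : |A| ≤ H)
    (hB : |B| ≤ H) (hAB : |A - B| < 2 * H) : t * (A + θ * (B - A)) - (A + B) < t * H := by
  rw [abs_le] at hA hB
  rw [abs_lt] at hAB
  set c := t * (1 - θ) - 1 with hc
  set d := t * θ - 1 with hd
  have hcd : c + d = t - 2 := by rw [hc, hd]; ring
  have hct : c + 1 ≤ t := by rw [hc]; nlinarith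
  have hdt : d + 1 ≤ t := by rw [hd]; nlinarith
  have hc1 : -1 ≤ c := by rw [hc]; nlinarith
  have hd1 : -1 ≤ d := by rw [hd]; nlinarith
  have hH : 0 < H := by linarith
  have hgoal : t * (A + θ * (B - A)) - (A + B) = c * A + d * B := by rw [hc, hd]; ring
  rw [hgoal]
  rcases le_or_gt 0 c with hc0 | hc0 <;> rcases le_or_gt 0 d with hd0 | hd0
  · nlinarith [mul_le_mul_of_nonneg_left hA.2 hc0, mul_le_mul_of_nonneg_left hB.2 hd0]
  · rcases le_or_gt 0 (c + d) with h | h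
    · nlinarith [mul_le_mul_of_nonneg_left hA.2 h, mul_lt_mul_of_pos_left hAB.2 (neg_pos.2 hd0)]
    · nlinarith [mul_le_mul_of_nonneg_left hAB.2.le hc0,
        mul_le_mul_of_nonneg_left hB.1 (neg_pos.2 h).le]
  · rcases le_or_gt 0 (c + d) with h | h
    · nlinarith [mul_le_mul_of_nonneg_left hB.2 h, mul_lt_mul_of_pos_left hAB.1 (neg_pos.2 hc0)]
    · nlinarith [mul_le_mul_of_nonneg_left hAB.1.le hd0,
        mul_le_mul_of_nonneg_left hA.1 (neg_pos.2 h).le]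
  · nlinarith [mul_le_mul_of_nonneg_left hA.1 (neg_pos.2 hc0).le,
      mul_le_mul_of_nonneg_left hB.1 (neg_pos.2 hd0).le]

namespace CentredDecagon

variable (D : CentredDecagon)

/-- The lattice of the translations that move the decagon to a neighbour along a side, and of
their compositions. -/
def lattice : Submodule ℤ Plane := Submodule.span ℤ (Set.range D.s)

lemma s_mem_lattice (k : ℕ) : D.s k ∈ D.lattice := Submodule.subset_span (Set.mem_range_self k)

lemma v_even_sub_mem_lattice (k : ℕ) : D.v (2 * k) - D.v 0 ∈ D.lattice := by
  induction k with
  | zero => simp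
  | succ k ih =>
    have := D.lattice.add_mem ih
      (D.lattice.sub_mem (D.s_mem_lattice (2 * k + 1)) (D.s_mem_lattice (2 * k)))
    rwa [show D.v (2 * k) - D.v 0 + (D.s (2 * k + 1) - D.s (2 * k)) =
      D.v (2 * (k + 1)) - D.v 0 by
        simp only [s, show 2 * (k + 1) = 2 * k + 1 + 1 by ring]; abel] at this

/-- Among the inner points that complete three consecutive vertices of the pentagon
`v 0, v 2, v 4, v 6, v 8` to a parallelogram there are three different ones. -/
lemma exists_three_inner : ∃ l : List Plane, l.Nodup ∧ l.length = 3 ∧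
    ∀ p ∈ l, p ∈ D.core ∧ p - D.v 0 ∈ D.lattice := by
  set z : ℕ → Plane := fun k => D.v (2 * k) + D.v (2 * k + 4) - D.v (2 * k + 2) with hz
  have hcore : ∀ k, z k ∈ D.core := fun k => by
    have := (D.shift (2 * k)).parallelogram_mem_core
    rwa [core_shift] at this
  have hlat : ∀ k, z k - D.v 0 ∈ D.lattice := fun k => by
    have := D.lattice.sub_mem (D.lattice.add_mem (D.v_even_sub_mem_lattice k)
      (D.v_even_sub_mem_lattice (k + 2))) (D.v_even_sub_mem_lattice (k + 1))
    rwa [show D.v (2 * k) - D.v 0 + (D.v (2 * (k + 2)) - D.v 0) - (D.v (2 * (k + 1)) - D.v 0) =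
      z k - D.v 0 by simp only [hz, mul_add, Nat.reduceMul]; abel] at this
  -- Only parallelograms at neighbouring vertices of the pentagon may share the fourth vertex.
  have hne : ∀ k, z k ≠ z (k + 2) := fun k h => by
    have h6 := D.antipodal (2 * k + 1)
    have h8 := D.antipodal (2 * k + 3)
    simp only [hz, mul_add, Nat.reduceMul] at h
    rw [show 2 * k + 4 + 4 = 2 * k + 3 + 5 by ring, show 2 * k + 4 + 2 = 2 * k + 1 + 5 by ring,
      h6, h8] at h
    refine D.e_ne (2 * k) (j := 2) (by norm_num) (by norm_num) ?_
    show D.v (2 * k + 3) - D.v (2 * k + 2) = D.v (2 * k + 1) - D.v (2 * k)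
    linear_combination (norm := module) h
  have hper : ∀ k, z (k + 5) = z k := fun k => by
    simp only [hz]
    rw [D.v_congr (j := 2 * (k + 5)) (l := 2 * k) (by omega),
      D.v_congr (j := 2 * (k + 5) + 4) (l := 2 * k + 4) (by omega),
      D.v_congr (j := 2 * (k + 5) + 2) (l := 2 * k + 2) (by omega)]
  have h02 := hne 0
  have h13 := hne 1
  have h24 := hne 2
  have h30 := hne 3
  have h41 := hne 4
  rw [hper 0] at h30
  rw [hper 1] at h41
  have key : ∀ a b c, z a ≠ z b → z a ≠ z c → z b ≠ z c → ∃ l : List Plane, l.Nodup ∧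
      l.length = 3 ∧ ∀ p ∈ l, p ∈ D.core ∧ p - D.v 0 ∈ D.lattice := fun a b c h1 h2 h3 =>
    ⟨[z a, z b, z c], by simp [h1, h2, h3], rfl, by simp [hcore, hlat]⟩
  by_cases h01 : z 0 = z 1
  · exact key 0 2 4 h02 (fun h => h41 (h.symm.trans h01)) h24
  by_cases h12 : z 1 = z 2
  · exact key 0 1 3 h01 h30.symm h13
  · exact key 0 1 2 h01 h02 h12

/-- The distance (up to a factor) of the centre from the line of side `l`. -/
def radius (l : ℕ) : ℝ := wedge (D.v l) (D.e l)

lemma gap_eq (l : ℕ) (p : Plane) : D.gap l p = D.radius l - wedge p (D.e l) := by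
  simp [gap, radius, wedge]; ring

lemma radius_pos (l : ℕ) : 0 < D.radius l := by
  have := D.zero_mem_core l
  rw [gap_eq] at this
  simpa [wedge] using this

lemma wedge_e_lt (j l : ℕ) : wedge (D.e j) (D.e l) < 2 * D.radius l := by
  suffices H : ∀ (D : CentredDecagon) (k : ℕ), k < 10 →
      wedge (D.e k) (D.e 0) < 2 * wedge (D.v 0) (D.e 0) by
    have := H (D.shift l) ((j + 9 * l) % 10) (Nat.mod_lt _ (by norm_num))
    rwa [shift_e, shift_e, shift_v, D.e_congr (l := j) (by omega), add_zero] at this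
  intro D k hk
  obtain ⟨h01, h02, h03, h04, h12, h13, h14, h23, h24, h34⟩ := D.turning_all
  have h5 := D.e_antipodal 0
  have h6 := D.e_antipodal 1
  have h7 := D.e_antipodal 2
  have h8 := D.e_antipodal 3
  have h9 := D.e_antipodal 4
  norm_num only at h5 h6 h7 h8 h9
  interval_cases k <;> simp only [h5, h6, h7, h8, h9, v_zero, wedge_add_left, wedge_smul_left,
    wedge_neg_left, wedge_self, D.wedge_e_anti] <;> linarith

/-- The norm with the decagon as unit ball. -/
noncomputable def norm (p : Plane) : ℝ :=
  (Finset.range 10).sup' (by simp) fun l => wedge p (D.e l) / D.radius l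

lemma norm_le_iff {p : Plane} {t : ℝ} :
    D.norm p ≤ t ↔ ∀ l, wedge p (D.e l) ≤ t * D.radius l := by
  rw [norm, Finset.sup'_le_iff]
  constructor
  · intro h l
    have h1 := h (l % 10) (Finset.mem_range.2 (Nat.mod_lt _ (by norm_num)))
    rw [div_le_iff₀ (D.radius_pos _)] at h1
    rwa [radius, D.e_congr (l := l) (by omega), v_mod] at h1
  · exact fun h l _ => (div_le_iff₀ (D.radius_pos _)).2 (h l)

lemma smul_mem_region {p : Plane} {t : ℝ} (ht : 0 < t) (h : D.norm p ≤ t) :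
    t⁻¹ • p ∈ D.region := by
  intro l
  have := D.norm_le_iff.1 h l
  rw [gap_eq, wedge_smul_left, sub_nonneg, inv_mul_le_iff₀ ht]
  exact this

lemma mem_region_of_norm_le_one {p : Plane} (h : D.norm p ≤ 1) : p ∈ D.region := by
  simpa using D.smul_mem_region one_pos h

lemma norm_sub_s_lt {p : Plane} (hp : 1 < D.norm p) : ∃ j, D.norm (p - D.s j) < D.norm p := by
  obtain ⟨j, -, hj⟩ := Finset.exists_mem_eq_sup' (s := Finset.range 10) (by simp)
    fun l => wedge p (D.e l) / D.radius l
  change D.norm p = _ at hj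
  set t := D.norm p
  have ht : 0 < t := by linarith
  have hq := D.smul_mem_region ht le_rfl
  have hg : D.gap j (t⁻¹ • p) = 0 := by
    rw [gap_eq, wedge_smul_left, hj]
    have h1 := D.radius_pos j
    have h2 : wedge p (D.e j) ≠ 0 := fun h => by rw [h, zero_div] at hj; linarith
    field_simp
    simp
  obtain ⟨θ, h0, h1, hθ⟩ := D.exists_of_gap_eq_zero hq hg
  have hpe : p = t • (D.v j + θ • D.e j) := by
    rw [← hθ, smul_smul, mul_inv_cancel₀ ht.ne', one_smul]
  refine ⟨j, ?_⟩
  have hbound : ∀ k l, |wedge (D.v k) (D.e l)| ≤ D.radius l := fun k l => by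
    have h2 := D.v_mem_region k l
    have h3 := D.neg_mem_region (D.v_mem_region k) l
    rw [gap_eq] at h2 h3
    rw [wedge_neg_left] at h3
    exact abs_le.2 ⟨by linarith, by linarith⟩
  rw [norm, Finset.sup'_lt_iff]
  intro l _
  rw [div_lt_iff₀ (D.radius_pos l)]
  have hes : wedge (D.e j) (D.e l) = wedge (D.v (j + 1)) (D.e l) - wedge (D.v j) (D.e l) := by
    rw [e, wedge_sub_left]
  have h4 := D.wedge_e_lt j l
  have h5 := D.wedge_e_lt (j + 5) l
  rw [e_antipodal, wedge_neg_left] at h5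
  rw [hes] at h4 h5
  have := descent_estimate hp h0 h1 (hbound j l) (hbound (j + 1) l)
    (abs_lt.2 ⟨by linarith, by linarith⟩)
  rw [hpe, s, wedge_sub_left, wedge_smul_left, wedge_add_left, wedge_add_left, wedge_smul_left,
    hes]
  exact this

/-- If the lattice is discrete, its translates of the decagon cover the plane: a point of
`p + Λ` with minimal norm lies in the decagon. -/
lemma exists_sub_mem_region (hfin : ∀ R : ℝ, {x | x ∈ D.lattice ∧ ‖x‖ ≤ R}.Finite) (p : Plane) :
    ∃ x ∈ D.lattice, p - x ∈ D.region := by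
  obtain ⟨R, hR⟩ := isBounded_iff_forall_norm_le.1 D.isBounded_region
  set t := max (D.norm p) 1
  have ht : 0 < t := lt_max_of_lt_right one_pos
  have hS : {x | x ∈ D.lattice ∧ D.norm (p - x) ≤ t}.Finite := by
    refine (hfin (‖p‖ + t * R)).subset fun x hx => ⟨hx.1, ?_⟩
    have h := hR _ (D.smul_mem_region ht hx.2)
    rw [norm_smul, norm_inv, Real.norm_of_nonneg ht.le, inv_mul_le_iff₀ ht] at h
    calc ‖x‖ = ‖p - (p - x)‖ := by rw [sub_sub_cancel]
      _ ≤ _ := (norm_sub_le _ _).trans (by linarith)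
  obtain ⟨x, ⟨hx, hxt⟩, hmin⟩ := hS.exists_minimalFor (fun x => D.norm (p - x)) _
    ⟨0, D.lattice.zero_mem, by simp [t]⟩
  refine ⟨x, hx, D.mem_region_of_norm_le_one ?_⟩
  by_contra! h
  obtain ⟨j, hj⟩ := D.norm_sub_s_lt h
  rw [sub_sub] at hj
  have := hmin (j := x + D.s j) ⟨D.lattice.add_mem hx (D.s_mem_lattice j), hj.le.trans hxt⟩ hj.le
  exact absurd hj this.not_gt

lemma span_lattice : Submodule.span ℝ (D.lattice : Set Plane) = ⊤ := by
  obtain ⟨h01, h02, h03, h04, h12, h13, h14, h23, h24, h34⟩ := D.turning_all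
  rw [eq_top_iff]
  intro p _
  have hpos : 0 < wedge (D.s 3) (D.s 4) := by
    simp only [s_three, s_four, wedge_add_left, wedge_sub_left, wedge_add_right, wedge_self,
      D.wedge_e_anti]
    linarith
  rw [show p = (wedge (D.s 3) (D.s 4))⁻¹ • (wedge (D.s 3) (D.s 4) • p) by
    rw [smul_smul, inv_mul_cancel₀ hpos.ne', one_smul], wedge_smul_eq]
  exact Submodule.smul_mem _ _ (Submodule.add_mem _
    (Submodule.smul_mem _ _ (Submodule.subset_span (D.s_mem_lattice 3)))
    (Submodule.smul_mem _ _ (Submodule.subset_span (D.s_mem_lattice 4))))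

namespace IsTiling

variable {D} {ι : Type*} {X : ι → Plane} (hX : D.IsTiling X)
include hX

lemma mult_pos (i : ι) : 1 ≤ mult X (X i) :=
  (Set.ncard_pos (hX.finite_mult _)).2 ⟨i, rfl⟩

lemma mult_add_lattice {a : Plane} (ha : a ∈ D.lattice) : ∀ x, mult X (x + a) = mult X x := by
  induction ha using Submodule.span_induction with
  | mem a h => obtain ⟨k, rfl⟩ := h; exact hX.mult_add_s k
  | zero => simp
  | add a b _ _ ha hb => intro x; rw [← add_assoc, hb, ha]
  | smul n a _ ha =>
    induction n with
    | zero => simp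
    | succ n ih => intro x; rw [add_smul, one_smul, ← add_assoc, ha, ih]
    | pred n ih =>
      intro x
      rw [← ha, sub_smul, one_smul, add_assoc, sub_add_cancel, ih]

lemma finite_lattice (i : ι) (R : ℝ) : {a | a ∈ D.lattice ∧ ‖a‖ ≤ R}.Finite := by
  refine ((hX.finite_of_isBounded (B := Metric.closedBall (X i) R)
    Metric.isBounded_closedBall).image fun j => X j - X i).subset ?_
  rintro a ⟨ha, hR⟩
  obtain ⟨j, hj⟩ := exists_index_of_mult_pos (x := X i + a)
    (by rw [hX.mult_add_lattice ha]; exact hX.mult_pos i)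
  refine ⟨j, ?_, by simp [hj]⟩
  show X j ∈ Metric.closedBall (X i) R
  rw [hj, mem_closedBall_iff_norm]
  simpa using hR

/-- At the vertex `y = X i + v 0` the class of `X i` modulo the lattice alone has five vertices and
at least three inner points. So it uses up the multiplicity five: its members are simple, and no
point of another class is close to `y`. -/
lemma mult_eq_one_and_close (i : ι) : mult X (X i) = 1 ∧
    ∀ j, X i + D.v 0 - X j ∈ D.region → X j - X i ∈ D.lattice := by
  obtain ⟨l, hl, hl3, hlp⟩ := D.exists_three_inner
  set y := X i + D.v 0 with hy
  have hm := hX.mult_pos i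
  have hmem : ∀ p, p - D.v 0 ∈ D.lattice → mult X (y - p) = mult X (X i) := fun p hp => by
    rw [← hX.mult_add_lattice hp]
    congr 1
    rw [hy]; abel
  have hsum : (l.map fun p => mult X (y - p)).sum = 3 * mult X (X i) := by
    rw [List.map_congr_left fun p hp => hmem p (hlp p hp).2, List.map_const', List.sum_replicate,
      hl3, smul_eq_mul]
  have h3 := hX.list_sum_mult_le y l hl fun p hp => (hlp p hp).1
  have htwo := hX.two_mul_count y
  have hv0 := hX.mult_add_mult 0 y
  rw [hmem (D.v 0) (by simp)] at hv0
  refine ⟨by omega, fun j hj => ?_⟩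
  by_contra hcon
  have hmj := hX.mult_pos j
  rcases D.mem_core_or_side_or_vertex hj with h | ⟨k, hk, h⟩ | ⟨k, hk, h⟩
  · have hnd : ((y - X j) :: l).Nodup := by
      refine List.nodup_cons.2 ⟨fun h' => hcon ?_, hl⟩
      have := D.lattice.neg_mem (hlp _ h').2
      rwa [show -(y - X j - D.v 0) = X j - X i by rw [hy]; abel] at this
    have h4 := hX.list_sum_mult_le y _ hnd fun p hp => by
      rcases List.mem_cons.1 hp with rfl | hp
      · exact h
      · exact (hlp p hp).1
    rw [List.map_cons, List.sum_cons, sub_sub_cancel] at h4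
    omega
  · have hs : count X (D.side k) y ≤ D.sideCount X y :=
      Finset.single_le_sum (f := fun j => count X (D.side j) y) (fun _ _ => Nat.zero_le _)
        (Finset.mem_range.2 hk)
    have hpos : 0 < count X (D.side k) y := by
      refine (Set.ncard_pos (hX.finite_of_subset_region (fun p hp l => ?_) y)).2 ⟨j, h⟩
      by_cases hl : l % 10 = k % 10
      · rw [D.gap_congr hl, hp.1]
      · exact (hp.2 l hl).le
    omega
  · have hjk : X j = y - D.v k := by rw [← h, sub_sub_cancel]
    rcases Nat.even_or_odd' k with ⟨r, rfl | rfl⟩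
    · apply hcon
      have := D.lattice.neg_mem (D.v_even_sub_mem_lattice r)
      rwa [show -(D.v (2 * r) - D.v 0) = X j - X i by rw [hjk, hy]; abel] at this
    · have h5 := hX.mult_add_mult (2 * r + 1) y
      have h6 := D.antipodal (2 * r + 1)
      have h7 := hmem (D.v (2 * (r + 3))) (D.v_even_sub_mem_lattice (r + 3))
      rw [show 2 * (r + 3) = 2 * r + 1 + 5 by ring, h6, sub_neg_eq_add] at h7
      rw [← hjk] at h5
      omega

/-- All members of a five-fold tiling are congruent modulo the lattice. -/
lemma sub_mem_lattice (i j : ι) : X j - X i ∈ D.lattice := by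
  obtain ⟨a, ha, har⟩ := D.exists_sub_mem_region (hX.finite_lattice i) (X i + D.v 0 - X j)
  obtain ⟨k, hk⟩ := exists_index_of_mult_pos (x := X j + a)
    (by rw [hX.mult_add_lattice ha]; exact hX.mult_pos j)
  have := (hX.mult_eq_one_and_close i).2 k (by rw [hk, ← sub_sub]; exact har)
  rw [hk] at this
  have := D.lattice.sub_mem this ha
  rwa [show X j + a - X i - a = X j - X i by abel] at this

lemma injective : Function.Injective X := by
  intro i j h
  have h1 := (hX.mult_eq_one_and_close j).1
  obtain ⟨k, hk⟩ := Set.ncard_eq_one.1 h1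
  have hi : i ∈ {i | X i = X j} := h
  have hj : j ∈ {i | X i = X j} := rfl
  rw [hk] at hi hj
  exact hi.trans hj.symm

lemma discreteTopology_lattice (i : ι) : DiscreteTopology D.lattice := by
  have hfin : ((Metric.closedBall (0 : D.lattice) 1)).Finite := by
    refine Set.Finite.of_finite_image (f := fun a : D.lattice => (a : Plane)) ?_
      Subtype.val_injective.injOn
    refine (hX.finite_lattice i 1).subset ?_
    rintro _ ⟨a, ha, rfl⟩
    exact ⟨a.2, by simpa using ha⟩
  refine discreteTopology_of_isOpen_singleton_zero ?_
  rw [isOpen_singleton_iff_nhds_eq_pure]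
  have hz : ({0} : Set D.lattice) ∈ nhds (0 : D.lattice) := by
    have h1 : (Metric.closedBall (0 : D.lattice) 1 \ {0}).Finite := hfin.sdiff
    filter_upwards [Metric.closedBall_mem_nhds (0 : D.lattice) one_pos,
      h1.isClosed.isOpen_compl.mem_nhds (by simp)] with a ha ha'
    by_contra hne
    exact ha' ⟨ha, hne⟩
  exact le_antisymm (Filter.le_pure_iff.2 hz) (pure_le_nhds 0)

end IsTiling

end CentredDecagon

theorem lemma6 {ι : Type*} (P : Set Plane) (X : ι → Plane)
    (hP : IsConvexPolygon 10 P) (hsymm : IsCentredSymmetric P)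
    (hX : IsDiscreteMultiset X) (htile : IsFoldTiling 5 P X) :
    IsFoldLatticeTiling 5 P X := by
  obtain ⟨D, rfl⟩ := exists_centredDecagon hP hsymm
  have hT := CentredDecagon.isTiling_of_isFoldTiling htile
  obtain ⟨i, -⟩ : {i | (0 : Plane) - X i ∈ D.region}.Nonempty := by
    rw [← Set.encard_pos]
    exact lt_of_lt_of_le (by norm_num) (hT 0).1
  have hrange : ∀ x, x - X i ∈ D.lattice → ∃ j, X j = x := fun x hx =>
    exists_index_of_mult_pos (by
      rw [← hT.mult_add_lattice (D.lattice.neg_mem hx), neg_sub, add_sub_cancel]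
      exact hT.mult_pos i)
  have hdisc := hT.discreteTopology_lattice i
  refine ⟨htile, D.lattice, hdisc, ⟨D.span_lattice⟩, ⟨hT.injective, X i, ?_⟩, fun p => ?_⟩
  · ext x
    refine ⟨?_, fun hx => hrange x hx⟩
    rintro ⟨j, rfl⟩
    exact hT.sub_mem_lattice i j
  · let f : ι → D.lattice := fun j => ⟨X j - X i, hT.sub_mem_lattice i j⟩
    have hf : Function.Bijective f := by
      refine ⟨fun j k h => hT.injective (sub_left_injective (congrArg Subtype.val h)), fun a => ?_⟩
      obtain ⟨j, hj⟩ := hrange (X i + (a : Plane)) (by simp)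
      exact ⟨j, Subtype.ext (by simp [f, hj])⟩
    have hcard : ∀ K : Set Plane, {a : D.lattice | p - (a : Plane) ∈ K}.encard =
        {j | p + X i - X j ∈ K}.encard := by
      intro K
      rw [← Set.encard_preimage_of_bijective hf]
      congr 1
      ext j
      simp only [Set.mem_preimage, Set.mem_ofPred_eq, f]
      rw [sub_sub_eq_add_sub]
    rw [hcard, hcard]
    exact htile (p + X i)
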